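/- Consider $N$ sites and $M$ sensors. Site $i$ has a dynamics matrix $A_i\in\mathbb R^{n_i\times n_i}$, a process noise spectral density $W_i\succeq 0$ and an initial error covariance $\Sigma_{i,0}\succ 0$; when it is observed by sensor $j$, the measurement matrix is $C_{ij}$ and the measurement noise spectral density is $V_{ij}\succ 0$. Assume that for every $i$ the pair $(A_i,W_i^{1/2})$ is controllable and that there is a set $J_i$ of sensors such that $(A_i,\tilde C_i)$ is detectable, where $\tilde C_i$ stacks the $C_{ij}$, $j\in J_i$. Let $P=[p_{ij}]\in\mathbb R^{N\times M}$ satisfy $0\le p_{ij}\le 1$, $\sum_i p_{ij}\le 1$ for all $j$, $\sum_j p_{ij}\le 1$ for all $i$, and suppose that for every $i$ there is $Q_i\succ 0$ with $$Q_iA_i+A_i^TQ_i+Q_iW_iQ_i-\sum_{j}p_{ij}C_{ij}^TV_{ij}^{-1}C_{ij}\preceq 0 .$$ (That is, $P$ is part of a feasible point of the program that minimizes $\sum_i\{\mathrm{Tr}(T_iQ_i^{-1})+\sum_j\kappa_{ij}p_{ij}\}$ over all such $Q_i$, $p_{ij}$, where $T_i\succeq 0$ are weights and $\kappa_{ij}$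 are observation costs; in particular $P$ may be an optimal solution.) Let $P=\sum_{k=1}^K\phi_kP_k$ with $\phi_k>0$, $\sum_k\phi_k=1$, where each $P_k$ is a zero-one matrix with at most one unit in each row and each column. For $\epsilon>0$, the periodic switching policy $\pi^\epsilon$ of period $\epsilon$ uses on $[(l+\phi_1+\dots+\phi_{k-1})\epsilon,(l+\phi_1+\dots+\phi_k)\epsilon)$, $l\in\mathbb N$, the assignment $P_k$, i.e. $\pi^\epsilon(t)=P_k$ there. Let $\Sigma_i^\epsilon$ be the solution on $[0,\infty)$ of $$\dot\Sigma=A_i\Sigma+\Sigma A_i^T+W_i-\Sigma\Big(\sum_j\pi^\epsilon_{ij}(t)C_{ij}^TV_{ij}^{-1}C_{ij}\Big)\Sigma,\qquad \Sigma(0)=\Sigma_{i,0}.$$ Then for every $i$: 1. The averaged algebraic Riccati equation $A_i\Sigma+\Sigma A_i^T+W_i-\Sigma\big(\sum_jp_{ij}C_{ij}^TV_{ij}^{-1}C_{ij}\big)\Sigma=0$ has exactly one positive definite stabilizing solution $\Sigma_i^*$, i.e. one for which $A_i-\Sigma_i^*\sum_jp_{ij}C_{ij}^TV_{ij}^{-1}C_{ij}$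 has all its eigenvalues in the open left half plane. 2. For every $\epsilon>0$ the solution $\Sigma_i^\epsilon$ exists and there is exactly one $\epsilon$-periodic function $\bar\Sigma_i^\epsilon$ with $\Sigma_i^\epsilon(t)-\bar\Sigma_i^\epsilon(t)\to 0$ as $t\to\infty$. 3. $\bar\Sigma_i^\epsilon(t)-\Sigma_i^*=O(\epsilon)$ as $\epsilon\to 0$, uniformly in $t\ge 0$: there are $K>0$ and $\epsilon_0>0$ such that every entry of $\bar\Sigma_i^\epsilon(t)-\Sigma_i^*$ is at most $K\epsilon$ in absolute value, for all $0<\epsilon\le\epsilon_0$ and all $t\ge 0$. -/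

import Mathlib

/-- A real square matrix is Hurwitz: all its complex eigenvalues have negative real part. -/
def Hurwitz {n : ℕ} (A : Matrix (Fin n) (Fin n) ℝ) : Prop :=
  ∀ z ∈ spectrum ℂ (A.map (algebraMap ℝ ℂ)), z.re < 0

/-- The pair `(A, C)` is detectable: some output injection makes `A` Hurwitz. -/
def Detectable {n : ℕ} {r : Type} [Fintype r] (A : Matrix (Fin n) (Fin n) ℝ)
    (C : Matrix r (Fin n) ℝ) : Prop :=
  ∃ L : Matrix (Fin n) r ℝ, Hurwitz (A - L * C)

/-- The controllability matrix `[B, A B, …, A ^ (n - 1) B]`. -/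
def controllabilityMatrix {n : ℕ} (A B : Matrix (Fin n) (Fin n) ℝ) :
    Matrix (Fin n) (Fin n × Fin n) ℝ :=
  Matrix.of fun a q => (A ^ (q.1 : ℕ) * B) a q.2

/-- The pair `(A, B)` is controllable: its controllability matrix has full rank. -/
def Controllable {n : ℕ} (A B : Matrix (Fin n) (Fin n) ℝ) : Prop :=
  (controllabilityMatrix A B).rank = n

/-- The data of `N` linear time-invariant sites observed by `M` sensors. Site `i` has state
dimension `n i`, dynamics matrix `A i`, process-noise spectral density `W i` and initial
covariance `cov0 i`; when it is observed by sensor `j`, the measurement matrix is `C i j`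
and the measurement-noise spectral density is `V i j`. -/
structure SensorModel (N M : ℕ) where
  n : Fin N → ℕ
  m : Fin N → Fin M → ℕ
  A : ∀ i, Matrix (Fin (n i)) (Fin (n i)) ℝ
  W : ∀ i, Matrix (Fin (n i)) (Fin (n i)) ℝ
  C : ∀ i j, Matrix (Fin (m i j)) (Fin (n i)) ℝ
  V : ∀ i j, Matrix (Fin (m i j)) (Fin (m i j)) ℝ
  cov0 : ∀ i, Matrix (Fin (n i)) (Fin (n i)) ℝ
  W_posSemidef : ∀ i, (W i).PosSemidef
  V_posDef : ∀ i j, (V i j).PosDef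

namespace SensorModel

variable {N M : ℕ} (S : SensorModel N M)

/-- The measurement matrices of site `i` by the sensors in `J`, stacked on top of each other. -/
def stackedC (i : Fin N) (J : Finset (Fin M)) :
    Matrix ((j : {j // j ∈ J}) × Fin (S.m i j)) (Fin (S.n i)) ℝ :=
  Matrix.of fun r b => S.C i r.1 r.2 b

/-- Every site is detectable through some set of sensors. -/
def SitesDetectable : Prop :=
  ∀ i, ∃ J : Finset (Fin M), Detectable (S.A i) (S.stackedC i J)

open scoped MatrixOrder in
/-- Every pair `(A i, (W i) ^ (1 / 2))` is controllable; the root is the positive semidefinite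
square root. -/
noncomputable def SitesControllable : Prop :=
  ∀ i, Controllable (S.A i) (CFC.sqrt (S.W i))

/-- The weighted information matrix `∑ j, w j • (C i j)ᵀ (V i j)⁻¹ (C i j)` of site `i`. -/
noncomputable def info (i : Fin N) (w : Fin M → ℝ) : Matrix (Fin (S.n i)) (Fin (S.n i)) ℝ :=
  ∑ j, w j • ((S.C i j).transpose * (S.V i j)⁻¹ * S.C i j)

/-- The Riccati operator `X ↦ A X + X Aᵀ + W - X (∑ j, w j • Cᵀ V⁻¹ C) X` of site `i`. -/
noncomputable def riccati (i : Fin N) (w : Fin M → ℝ)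
    (X : Matrix (Fin (S.n i)) (Fin (S.n i)) ℝ) : Matrix (Fin (S.n i)) (Fin (S.n i)) ℝ :=
  S.A i * X + X * (S.A i).transpose + S.W i - X * S.info i w * X

/-- `P` is the matrix of fractions of a feasible point of the convex program for the performance
bound: `P` has nonnegative entries, row and column sums at most one (so that the entries are at
most one), and for every site there is `Q ≻ 0` with
`Q A + Aᵀ Q + Q W Q - ∑ j, P i j • Cᵀ V⁻¹ C ⪯ 0`. -/
structure Feasible (P : Matrix (Fin N) (Fin M) ℝ) : Prop where
  nonneg : ∀ i j, 0 ≤ P i j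
  le_one : ∀ i j, P i j ≤ 1
  sum_sites_le : ∀ j, ∑ i, P i j ≤ 1
  sum_sensors_le : ∀ i, ∑ j, P i j ≤ 1
  riccati_inequality : ∀ i, ∃ Q : Matrix (Fin (S.n i)) (Fin (S.n i)) ℝ, Q.PosDef ∧
    (S.info i (P i) -
      (Q * S.A i + (S.A i).transpose * Q + Q * S.W i * Q)).PosSemidef

/-- `X` is the positive definite stabilizing solution of the algebraic Riccati equation of site
`i` with sensor weights `w`. -/
structure IsStabilizingSolution (i : Fin N) (w : Fin M → ℝ)
    (X : Matrix (Fin (S.n i)) (Fin (S.n i)) ℝ) : Prop where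
  posDef : X.PosDef
  equation : S.riccati i w X = 0
  stabilizing : Hurwitz (S.A i - X * S.info i w)

end SensorModel

/-- A partial assignment: a zero-one matrix with at most one unit in each row and each column. -/
structure IsAssignment {N M : ℕ} (P : Matrix (Fin N) (Fin M) ℝ) : Prop where
  zero_or_one : ∀ i j, P i j = 0 ∨ P i j = 1
  row : ∀ i j j', P i j = 1 → P i j' = 1 → j = j'
  col : ∀ i i' j, P i j = 1 → P i' j = 1 → i = i'

/-- A finite convex decomposition `P = ∑ k, φ k • assign k` of the matrix of fractions into
partial assignments, with positive weights `φ k`. -/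
structure AssignmentDecomposition {N M : ℕ} (P : Matrix (Fin N) (Fin M) ℝ) where
  K : ℕ
  φ : Fin K → ℝ
  assign : Fin K → Matrix (Fin N) (Fin M) ℝ
  φ_pos : ∀ k, 0 < φ k
  φ_sum : ∑ k, φ k = 1
  isAssignment : ∀ k, IsAssignment (assign k)
  decomposition : P = ∑ k, φ k • assign k

namespace AssignmentDecomposition

variable {N M : ℕ} {P : Matrix (Fin N) (Fin M) ℝ} (D : AssignmentDecomposition P)

/-- `D.Active ε k t`: at time `t` the periodic switching policy of period `ε` uses the `k`-th
assignment, that is, `(l + ∑ l' < k, φ l') ε ≤ t < (l + ∑ l' ≤ k, φ l') ε` for the integer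
`l = ⌊t / ε⌋`. -/
def Active (ε : ℝ) (k : Fin D.K) (t : ℝ) : Prop :=
  ∑ l ∈ Finset.Iio k, D.φ l ≤ Int.fract (t / ε) ∧
    Int.fract (t / ε) < ∑ l ∈ Finset.Iic k, D.φ l

open scoped Classical in
/-- The periodic switching policy of period `ε`: the matrix of the assignment in use at time `t`
(exactly one `k` is active). -/
noncomputable def policy (ε t : ℝ) : Matrix (Fin N) (Fin M) ℝ :=
  ∑ k, if D.Active ε k t then D.assign k else 0

end AssignmentDecomposition

namespace SensorModel

variable {N M : ℕ} (S : SensorModel N M)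

/-- `X` is, on `[0, ∞)`, the error covariance of site `i` under the policy `π`, i.e. the solution
of the Riccati differential equation
`X' = A X + X Aᵀ + W - X (∑ j, π i j (t) • Cᵀ V⁻¹ C) X`, `X 0 = cov0 i`.
Since `π` is a right-continuous step function of time, a solution is a continuous function whose
right derivative is given by the equation at every time. -/
structure IsErrorCovariance (i : Fin N) (π : ℝ → Matrix (Fin N) (Fin M) ℝ)
    (X : ℝ → Matrix (Fin (S.n i)) (Fin (S.n i)) ℝ) : Prop where
  initial : X 0 = S.cov0 i
  continuousOn : ContinuousOn X (Set.Ici 0)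
  equation : ∀ t, 0 ≤ t → ∀ a b,
    HasDerivWithinAt (fun s => X s a b) (S.riccati i (π t i) (X t) a b) (Set.Ici t) t

/-- `Y` is the periodic limit, of period `ε`, of the error covariance of site `i` under the
periodic switching policy of period `ε`. -/
def IsPeriodicLimit {P : Matrix (Fin N) (Fin M) ℝ} (D : AssignmentDecomposition P) (i : Fin N)
    (ε : ℝ) (Y : ℝ → Matrix (Fin (S.n i)) (Fin (S.n i)) ℝ) : Prop :=
  Function.Periodic Y ε ∧
    ∃ X, S.IsErrorCovariance i (D.policy ε) X ∧
      Filter.Tendsto (fun t => X t - Y t) Filter.atTop (nhds 0)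

end SensorModel

set_option linter.unusedSectionVars false

/-! Fix a site and let `R t` be its switched information matrix, `R₀` the average. The main tool is
comparison (`IsFlow.ge_of_subsolution`): if `U` solves the adjoint of the closed loop of a solution
`X`, and `Z` is a subsolution, then `Uᵀ (X - Z) U` has positive semidefinite derivative. Hence the
Riccati flow is monotone and, its operator being concave, concave in the initial value
(`IsFlow.concave`). By controllability, even the solution starting at zero is positive definite at
every positive time (`IsFlow.posDef`). Global existence comes from the linear Hamiltonian system
(`exists_isFlow`).

If some positive definite initial value does not increase over one period (`HasSuper`), all
solutions are bounded. Concavity, together with the positive gain of the zero solution over a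
period, then contracts the ratio of any two solutions geometrically (`PeriodicSystem.contract`). So
a periodic solution exists and attracts every solution with positive definite initial value.

The feasible `Q` supplies `HasSuper` (`PeriodicSystem.hasSuper`). In the dual equation for the
inverse, a small multiple of `Q` plus an observability Gramian is shown not to decrease over a
period. Directions invisible to the switched system are invisible to each assignment, hence to the
average; there the matrix inequality and controllability make `Q` decrease strictly along `A`. With
constant `R₀` the same theory gives the stabilizing solution, because the periodic solution is then
constant (`exists_equilibrium`).

For the `O(ε)` bound, let `S` be the inverse of the equilibrium, `p = O(ε)` a primitive of `R - R₀`,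
and `L` a strict Lyapunov matrix for the linearized dual equation (`exists_strict_lyapunov`). For
`κ` of order `ε`, `S + p - κ L` and `S + p + κ L` are a subsolution and a supersolution of the dual
equation. Inverting them traps the periodic limit (`periodic_limit_sandwich`). -/

namespace Riccati

open Matrix Set Filter Topology

/-! ### One-sided matrix calculus and quadratic forms -/

section Calculus

variable {m k l ι : Type*} [Fintype m] [Fintype k] [Fintype l] [Fintype ι]

/-- `X` is continuous on `[0, ∞)` and `X' t` is its entrywise right derivative at every
`t ≥ 0`. -/
structure RightDiff (X X' : ℝ → Matrix m k ℝ) : Prop where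
  cont : ContinuousOn X (Ici 0)
  deriv : ∀ t, 0 ≤ t → ∀ a b, HasDerivWithinAt (fun s => X s a b) (X' t a b) (Ici t) t

theorem continuousOn_matrix_iff {X : ℝ → Matrix m k ℝ} {s : Set ℝ} :
    ContinuousOn X s ↔ ∀ a b, ContinuousOn (fun t => X t a b) s := by
  refine ⟨fun h a b => ?_, fun h => ?_⟩
  · exact (continuous_id.matrix_elem a b).comp_continuousOn h
  · exact continuousOn_pi.2 fun a => continuousOn_pi.2 fun b => h a b

namespace RightDiff

variable {X X' Y Y' : ℝ → Matrix m k ℝ}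

theorem of_entries (hc : ∀ a b, ContinuousOn (fun t => X t a b) (Ici 0))
    (hd : ∀ t, 0 ≤ t → ∀ a b, HasDerivWithinAt (fun s => X s a b) (X' t a b) (Ici t) t) :
    RightDiff X X' :=
  ⟨continuousOn_matrix_iff.2 hc, hd⟩

theorem entry (h : RightDiff X X') (a : m) (b : k) :
    ContinuousOn (fun t => X t a b) (Ici 0) :=
  continuousOn_matrix_iff.1 h.cont a b

theorem congr_deriv (h : RightDiff X X') (e : ∀ t, 0 ≤ t → X' t = Y' t) : RightDiff X Y' :=
  ⟨h.cont, fun t ht a b => by rw [← e t ht]; exact h.deriv t ht a b⟩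

theorem const (C : Matrix m k ℝ) : RightDiff (fun _ => C) (fun _ => 0) :=
  ⟨continuousOn_const, fun _ _ _ _ => hasDerivWithinAt_const _ _ _⟩

theorem add (hX : RightDiff X X') (hY : RightDiff Y Y') :
    RightDiff (fun t => X t + Y t) (fun t => X' t + Y' t) :=
  of_entries (fun a b => (hX.entry a b).add (hY.entry a b))
    fun t ht a b => (hX.deriv t ht a b).add (hY.deriv t ht a b)

theorem sub (hX : RightDiff X X') (hY : RightDiff Y Y') :
    RightDiff (fun t => X t - Y t) (fun t => X' t - Y' t) :=
  of_entries (fun a b => (hX.entry a b).sub (hY.entry a b))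
    fun t ht a b => (hX.deriv t ht a b).sub (hY.deriv t ht a b)

theorem smul (c : ℝ) (hX : RightDiff X X') : RightDiff (fun t => c • X t) (fun t => c • X' t) :=
  of_entries (fun a b => (hX.entry a b).const_smul c)
    fun t ht a b => (hX.deriv t ht a b).const_smul c

theorem transpose (hX : RightDiff X X') : RightDiff (fun t => (X t)ᵀ) (fun t => (X' t)ᵀ) :=
  of_entries (fun a b => hX.entry b a) fun t ht a b => hX.deriv t ht b a

theorem mul {Z Z' : ℝ → Matrix k l ℝ} (hX : RightDiff X X') (hZ : RightDiff Z Z') :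
    RightDiff (fun t => X t * Z t) (fun t => X' t * Z t + X t * Z' t) := by
  refine of_entries (fun a b => ?_) fun t ht a b => ?_
  · simp only [mul_apply]
    exact continuousOn_finsetSum _ fun c _ => (hX.entry a c).mul (hZ.entry c b)
  · simp only [mul_apply, Matrix.add_apply, ← Finset.sum_add_distrib]
    exact HasDerivWithinAt.fun_sum fun c _ => (hX.deriv t ht a c).fun_mul (hZ.deriv t ht c b)

theorem const_mul (hX : RightDiff X X') (C : Matrix l m ℝ) :
    RightDiff (fun t => C * X t) (fun t => C * X' t) :=
  ((const C).mul hX).congr_deriv fun t _ => by simp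

theorem mul_const (hX : RightDiff X X') (C : Matrix k l ℝ) :
    RightDiff (fun t => X t * C) (fun t => X' t * C) :=
  (hX.mul (const C)).congr_deriv fun t _ => by simp

theorem submatrix {p r : Type*} [Fintype p] [Fintype r] (hX : RightDiff X X')
    (f : p → m) (g : r → k) :
    RightDiff (fun t => (X t).submatrix f g) (fun t => (X' t).submatrix f g) :=
  of_entries (fun _ _ => hX.entry _ _) fun t ht _ _ => hX.deriv t ht _ _

theorem comp_add (hX : RightDiff X X') {c : ℝ} (hc : 0 ≤ c) :
    RightDiff (fun t => X (t + c)) (fun t => X' (t + c)) := by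
  refine of_entries (fun a b => ?_) fun t ht a b => ?_
  · exact (hX.entry a b).comp (by fun_prop) fun t (ht : 0 ≤ t) => add_nonneg ht hc
  · have h := hX.deriv (t + c) (add_nonneg ht hc) a b
    have h2 : HasDerivWithinAt (fun s : ℝ => s + c) 1 (Ici t) t :=
      (hasDerivWithinAt_id t _).add_const c
    simpa using! h.comp t h2 fun s (hs : t ≤ s) => by simpa using hs

theorem mulVec_cont (hX : RightDiff X X') (c : k → ℝ) (a : m) :
    ContinuousOn (fun t => (X t *ᵥ c) a) (Ici 0) := by
  simp only [mulVec, dotProduct]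
  exact continuousOn_finsetSum _ fun b _ => (hX.entry a b).mul continuousOn_const

theorem mulVec_deriv (hX : RightDiff X X') (c : k → ℝ) (a : m) {t : ℝ} (ht : 0 ≤ t) :
    HasDerivWithinAt (fun s => (X s *ᵥ c) a) ((X' t *ᵥ c) a) (Ici t) t := by
  simp only [mulVec, dotProduct]
  exact HasDerivWithinAt.fun_sum fun b _ => (hX.deriv t ht a b).mul_const _

/-- If `X t *ᵥ c` vanishes on `[0, T)` then so does its right derivative. -/
theorem mulVec_deriv_eq_zero (hX : RightDiff X X') {c : k → ℝ} {T : ℝ}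
    (h : ∀ t, 0 ≤ t → t < T → X t *ᵥ c = 0) {t : ℝ} (ht : 0 ≤ t) (hT : t < T) :
    X' t *ᵥ c = 0 := by
  ext a
  have h1 := hX.mulVec_deriv c a ht
  have h2 : HasDerivWithinAt (fun s => (X s *ᵥ c) a) 0 (Ici t) t := by
    refine (hasDerivWithinAt_const t (Ici t) (0 : ℝ)).congr_of_eventuallyEq ?_
      (by simp [h t ht hT])
    filter_upwards [Ico_mem_nhdsGE hT] with s hs
    simp [h s (ht.trans hs.1) hs.2]
  exact (uniqueDiffWithinAt_Ici t).eq_deriv _ h1 h2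

/-- If the right derivative of `X t *ᵥ c` vanishes on `[0, T)`, it is constant. -/
theorem mulVec_const (hX : RightDiff X X') {c : k → ℝ} {T : ℝ} (hT : 0 ≤ T)
    (h : ∀ t, 0 ≤ t → t < T → X' t *ᵥ c = 0) : X T *ᵥ c = X 0 *ᵥ c := by
  ext a
  refine constant_of_has_deriv_right_zero (a := 0) (b := T) (f := fun t => (X t *ᵥ c) a)
    ((hX.mulVec_cont c a).mono Icc_subset_Ici_self) (fun t ht => ?_) T ⟨hT, le_rfl⟩
  have := hX.mulVec_deriv c a ht.1
  rwa [h t ht.1 ht.2] at this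

theorem const_of_deriv_zero (hX : RightDiff X (fun _ => 0)) {T : ℝ} (hT : 0 ≤ T) :
    X T = X 0 := by
  classical
  ext a b
  have := congrFun (hX.mulVec_const (c := Pi.single b 1) hT fun t _ _ => zero_mulVec _) a
  simpa using this

end RightDiff

theorem le_of_right_deriv_nonneg {f f' : ℝ → ℝ} {T : ℝ} (hT : 0 ≤ T)
    (hc : ContinuousOn f (Icc 0 T))
    (hd : ∀ t, 0 ≤ t → t < T → HasDerivWithinAt f (f' t) (Ici t) t)
    (h : ∀ t, 0 ≤ t → t < T → 0 ≤ f' t) : f 0 ≤ f T :=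
  image_le_of_deriv_right_le_deriv_boundary (f := fun _ => f 0) (f' := fun _ => 0)
    continuousOn_const (fun _ _ => hasDerivWithinAt_const _ _ _) le_rfl hc
    (fun t ht => hd t ht.1 ht.2) (fun t ht => h t ht.1 ht.2) ⟨hT, le_rfl⟩

/-- A function with nonnegative right derivative and no increase has derivative zero. -/
theorem right_deriv_eq_zero {f f' : ℝ → ℝ} {T : ℝ}
    (hc : ContinuousOn f (Icc 0 T))
    (hd : ∀ t, 0 ≤ t → t < T → HasDerivWithinAt f (f' t) (Ici t) t)
    (h : ∀ t, 0 ≤ t → t < T → 0 ≤ f' t) (he : f T ≤ f 0) {t : ℝ} (ht : 0 ≤ t) (htT : t < T) :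
    f' t = 0 := by
  have h0 : ∀ s, 0 ≤ s → s ≤ T → f s = f 0 := by
    intro s hs hsT
    have h1 : f 0 ≤ f s := le_of_right_deriv_nonneg hs (hc.mono (Icc_subset_Icc_right hsT))
      (fun r h0 h1 => hd r h0 (h1.trans_le hsT)) fun r h0 h1 => h r h0 (h1.trans_le hsT)
    have h2 : f s ≤ f T :=
      image_le_of_deriv_right_le_deriv_boundary (a := s) (b := T) (f := fun _ => f s)
        (f' := fun _ => 0) continuousOn_const (fun _ _ => hasDerivWithinAt_const _ _ _) le_rfl
        (hc.mono (Icc_subset_Icc_left hs)) (fun r hr => hd r (hs.trans hr.1) hr.2)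
        (fun r hr => h r (hs.trans hr.1) hr.2) ⟨hsT, le_rfl⟩
    linarith
  have h2 : HasDerivWithinAt f 0 (Ici t) t := by
    refine (hasDerivWithinAt_const t (Ici t) (f 0)).congr_of_eventuallyEq ?_
      (h0 t ht htT.le)
    filter_upwards [Ico_mem_nhdsGE htT] with s hs
    exact h0 s (ht.trans hs.1) hs.2.le
  exact (uniqueDiffWithinAt_Ici t).eq_deriv _ (hd t ht htT) h2

/-- The quadratic form of a matrix. -/
def quad (M : Matrix ι ι ℝ) (x : ι → ℝ) : ℝ := x ⬝ᵥ (M *ᵥ x)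

section quad

variable (M N : Matrix ι ι ℝ) (x y : ι → ℝ)

@[simp] theorem quad_add : quad (M + N) x = quad M x + quad N x := by
  simp [quad, add_mulVec]

@[simp] theorem quad_sub : quad (M - N) x = quad M x - quad N x := by
  simp [quad, sub_mulVec]

@[simp] theorem quad_neg : quad (-M) x = -quad M x := by
  simp [quad, neg_mulVec]

@[simp] theorem quad_smul (c : ℝ) : quad (c • M) x = c * quad M x := by
  simp [quad, smul_mulVec]

@[simp] theorem quad_zero : quad (0 : Matrix ι ι ℝ) x = 0 := by simp [quad]

@[simp] theorem quad_zero_right : quad M 0 = 0 := by simp [quad]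

theorem quad_smul_right (c : ℝ) : quad M (c • x) = c ^ 2 * quad M x := by
  simp [quad, mulVec_smul]; ring

theorem quad_conj (U : Matrix ι m ℝ) (x : m → ℝ) :
    quad (Uᵀ * M * U) x = quad M (U *ᵥ x) := by
  simp only [quad, ← mulVec_mulVec]
  rw [mulVec_transpose, dotProduct_comm, ← dotProduct_mulVec, dotProduct_comm]

theorem quad_mul (P : Matrix ι ι ℝ) : quad (P * M) x = (Pᵀ *ᵥ x) ⬝ᵥ (M *ᵥ x) := by
  rw [quad, ← mulVec_mulVec, dotProduct_mulVec, mulVec_transpose]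

variable {M} in
theorem symm_dot (hM : Mᵀ = M) : x ⬝ᵥ (M *ᵥ y) = y ⬝ᵥ (M *ᵥ x) := by
  rw [dotProduct_mulVec, ← mulVec_transpose, hM, dotProduct_comm]

variable {M} in
theorem quad_add_right (hM : Mᵀ = M) :
    quad M (x + y) = quad M x + 2 * (x ⬝ᵥ (M *ᵥ y)) + quad M y := by
  simp only [quad, mulVec_add, add_dotProduct, dotProduct_add, symm_dot y x hM]; ring

variable {M} in
theorem quad_sub_right (hM : Mᵀ = M) :
    quad M (x - y) = quad M x - 2 * (x ⬝ᵥ (M *ᵥ y)) + quad M y := by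
  simp only [quad, mulVec_sub, sub_dotProduct, dotProduct_sub, symm_dot y x hM]; ring

variable {M x} in
theorem mulVec_eq_zero_of_quad (hM : Mᵀ = M) (hp : ∀ x, 0 ≤ quad M x) (h : quad M x = 0) :
    M *ᵥ x = 0 := by
  have hM' : M.PosSemidef := by
    refine .of_dotProduct_mulVec_nonneg ?_ fun x => by simpa [quad] using hp x
    rw [IsHermitian, conjTranspose_eq_transpose_of_trivial, hM]
  exact (hM'.dotProduct_mulVec_zero_iff x).1 (by simpa [quad] using h)

end quad

theorem posDef_iff {M : Matrix ι ι ℝ} :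
    M.PosDef ↔ Mᵀ = M ∧ ∀ x, x ≠ 0 → 0 < quad M x := by
  rw [posDef_iff_dotProduct_mulVec, IsHermitian, conjTranspose_eq_transpose_of_trivial]
  simp [quad]

theorem posSemidef_iff {M : Matrix ι ι ℝ} :
    M.PosSemidef ↔ Mᵀ = M ∧ ∀ x, 0 ≤ quad M x := by
  rw [posSemidef_iff_dotProduct_mulVec, IsHermitian, conjTranspose_eq_transpose_of_trivial]
  simp [quad]

theorem continuous_quad (M : Matrix ι ι ℝ) : Continuous (quad M) :=
  continuous_id.dotProduct (continuous_const.matrix_mulVec continuous_id)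

theorem RightDiff.quad_cont {X X' : ℝ → Matrix ι ι ℝ} (hX : RightDiff X X') (c : ι → ℝ) :
    ContinuousOn (fun t => quad (X t) c) (Ici 0) := by
  simp only [quad, dotProduct]
  exact continuousOn_finsetSum _ fun a _ => continuousOn_const.mul (hX.mulVec_cont c a)

theorem RightDiff.quad_deriv {X X' : ℝ → Matrix ι ι ℝ} (hX : RightDiff X X') (c : ι → ℝ)
    {t : ℝ} (ht : 0 ≤ t) :
    HasDerivWithinAt (fun s => quad (X s) c) (quad (X' t) c) (Ici t) t := by
  simp only [quad, dotProduct]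
  exact HasDerivWithinAt.fun_sum fun a _ => (hX.mulVec_deriv c a ht).const_mul _

theorem RightDiff.quad_le {X X' : ℝ → Matrix ι ι ℝ} (hX : RightDiff X X') (c : ι → ℝ)
    {T : ℝ} (hT : 0 ≤ T) (h : ∀ t, 0 ≤ t → t < T → 0 ≤ quad (X' t) c) :
    quad (X 0) c ≤ quad (X T) c :=
  le_of_right_deriv_nonneg hT ((hX.quad_cont c).mono Icc_subset_Ici_self)
    (fun _ ht _ => hX.quad_deriv c ht) h

theorem RightDiff.quad_deriv_eq_zero {X X' : ℝ → Matrix ι ι ℝ} (hX : RightDiff X X')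
    (c : ι → ℝ) {T : ℝ} (h : ∀ t, 0 ≤ t → t < T → 0 ≤ quad (X' t) c)
    (he : quad (X T) c ≤ quad (X 0) c) {t : ℝ} (ht : 0 ≤ t) (htT : t < T) :
    quad (X' t) c = 0 :=
  right_deriv_eq_zero ((hX.quad_cont c).mono Icc_subset_Ici_self)
    (fun _ ht _ => hX.quad_deriv c ht) h he ht htT

end Calculus

end Riccati

namespace Riccati

open Matrix Set Filter Topology

/-! ### Matrix exponentials and linear equations with step coefficients -/

section LinearODE

variable {ι κ l : Type*} [Fintype ι] [DecidableEq ι] [Fintype κ] [DecidableEq κ]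

section Normed

attribute [local instance] Matrix.linftyOpNormedRing Matrix.linftyOpNormedAlgebra

theorem hasDerivWithinAt_matrix_iff {X : ℝ → Matrix ι ι ℝ} {X' : Matrix ι ι ℝ} {s : Set ℝ}
    {t : ℝ} :
    HasDerivWithinAt X X' s t ↔ ∀ a b, HasDerivWithinAt (fun s => X s a b) (X' a b) s t := by
  refine ⟨fun h a b => ?_, fun h => ?_⟩
  · let e : Matrix ι ι ℝ →L[ℝ] ℝ := LinearMap.toContinuousLinearMap (Matrix.entryLinearMap ℝ ℝ a b)
    exact e.hasFDerivAt.comp_hasDerivWithinAt t h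
  · have h1 : ∀ M : Matrix ι ι ℝ, M = ∑ a, ∑ b, M a b • Matrix.single a b (1 : ℝ) := by
      intro M
      conv_lhs => rw [matrix_eq_sum_single M]
      simp [Matrix.smul_single]
    have h2 : X = fun s => ∑ a, ∑ b, X s a b • Matrix.single a b (1 : ℝ) :=
      funext fun s => h1 (X s)
    rw [h2, h1 X']
    exact HasDerivWithinAt.fun_sum fun a _ => HasDerivWithinAt.fun_sum fun b _ =>
      (h a b).smul_const _

theorem hasDerivWithinAt_inv {X : ℝ → Matrix ι ι ℝ} {X' : Matrix ι ι ℝ} {s : Set ℝ} {t : ℝ}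
    (h : ∀ a b, HasDerivWithinAt (fun s => X s a b) (X' a b) s t) (hu : IsUnit (X t)) (a b : ι) :
    HasDerivWithinAt (fun s => (X s)⁻¹ a b) ((-((X t)⁻¹ * X' * (X t)⁻¹)) a b) s t := by
  suffices h0 : HasDerivWithinAt (fun s => (X s)⁻¹) (-((X t)⁻¹ * X' * (X t)⁻¹)) s t from
    hasDerivWithinAt_matrix_iff.1 h0 a b
  obtain ⟨u, hu⟩ := hu
  have h1 := hasFDerivAt_ringInverse (𝕜 := ℝ) u
  rw [hu] at h1
  have h2 := h1.comp_hasDerivWithinAt t (hasDerivWithinAt_matrix_iff.2 h)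
  have h3 : (↑u⁻¹ : Matrix ι ι ℝ) = (X t)⁻¹ := by rw [← hu, Matrix.coe_units_inv]
  simp only [nonsing_inv_eq_ringInverse] at h3 ⊢
  simpa [Function.comp_def, h3] using! h2

theorem hasDerivAt_exp_smul (A : Matrix ι ι ℝ) (t : ℝ) (a b : ι) :
    HasDerivAt (fun s : ℝ => NormedSpace.exp (s • A) a b) ((A * NormedSpace.exp (t • A)) a b) t := by
  have h := hasDerivAt_exp_smul_const' (𝕂 := ℝ) A t
  rw [← hasDerivWithinAt_univ] at h ⊢
  exact hasDerivWithinAt_matrix_iff.1 h a b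

/-- The map `M ↦ B (M w)` is linear and continuous, so it may be applied to the exponential series
term by term. -/
theorem exp_smul_mem (A : Matrix ι ι ℝ) (t : ℝ) {B : Matrix κ ι ℝ} {w : ι → ℝ}
    (h : ∀ j : ℕ, B *ᵥ (A ^ j *ᵥ w) = 0) : B *ᵥ (NormedSpace.exp (t • A) *ᵥ w) = 0 := by
  have h1 := NormedSpace.exp_series_hasSum_exp' (𝕂 := ℝ) (t • A)
  let e : Matrix ι ι ℝ →ₗ[ℝ] (κ → ℝ) :=
    { toFun := fun M => B *ᵥ (M *ᵥ w)
      map_add' := fun M N => by simp [add_mulVec, mulVec_add]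
      map_smul' := fun c M => by simp [smul_mulVec, mulVec_smul] }
  have h2 := h1.mapL (LinearMap.toContinuousLinearMap e)
  have h3 : ∀ j : ℕ, e (((Nat.factorial j : ℝ)⁻¹) • (t • A) ^ j) = 0 := fun j => by
    have hj : e (A ^ j) = 0 := h j
    rw [map_smul, smul_pow, map_smul, hj, smul_zero, smul_zero]
  have h4 : HasSum (fun _ : ℕ => (0 : κ → ℝ)) (e (NormedSpace.exp (t • A))) := by
    exact (funext h3 : (fun j : ℕ => e (((Nat.factorial j : ℝ)⁻¹) • (t • A) ^ j)) = _) ▸ h2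
  exact (hasSum_zero.unique h4).symm

end Normed

theorem exp_smul_neg_mul (A : Matrix ι ι ℝ) (t : ℝ) :
    NormedSpace.exp (-t • A) * NormedSpace.exp (t • A) = 1 := by
  rw [← Matrix.exp_add_of_commute _ _ ((Commute.refl A).smul_left _ |>.smul_right _)]
  simp [NormedSpace.exp_zero]

theorem exp_smul_mul_neg (A : Matrix ι ι ℝ) (t : ℝ) :
    NormedSpace.exp (t • A) * NormedSpace.exp (-t • A) = 1 :=
  mul_eq_one_comm.1 (exp_smul_neg_mul A t)

theorem rightDiff_exp (A : Matrix ι ι ℝ) :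
    RightDiff (fun t : ℝ => NormedSpace.exp (t • A)) fun t => A * NormedSpace.exp (t • A) :=
  .of_entries (fun a b t _ => (hasDerivAt_exp_smul A t a b).continuousAt.continuousWithinAt)
    fun t _ a b => (hasDerivAt_exp_smul A t a b).hasDerivWithinAt

theorem RightDiff.inv {X X' : ℝ → Matrix ι ι ℝ} (hX : RightDiff X X')
    (hu : ∀ t, 0 ≤ t → IsUnit (X t)) :
    RightDiff (fun t => (X t)⁻¹) (fun t => -((X t)⁻¹ * X' t * (X t)⁻¹)) := by
  refine of_entries (fun a b t ht => ?_) fun t ht a b =>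
    hasDerivWithinAt_inv (hX.deriv t ht) (hu t ht) a b
  have h1 : (fun t => (X t)⁻¹ a b) = fun t => (X t).det⁻¹ * (X t).adjugate a b := by
    ext t
    simp [Matrix.inv_def]
  rw [h1]
  have h2 : ContinuousWithinAt (fun t => (X t).det) (Ici 0) t :=
    (continuous_id.matrix_det.comp_continuousOn hX.cont) t ht
  have h3 : ContinuousWithinAt (fun t => (X t).adjugate a b) (Ici 0) t :=
    ((continuous_id.matrix_adjugate.matrix_elem a b).comp_continuousOn hX.cont) t ht
  exact (h2.inv₀ ((isUnit_iff_isUnit_det _).1 (hu t ht)).ne_zero).mul h3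

/-- A piecewise constant function on `[0, ∞)` with locally finitely many jumps. -/
def IsStep {α : Type*} (R : ℝ → α) : Prop :=
  ∃ (b : ℕ → ℝ) (r : ℕ → α), StrictMono b ∧ b 0 = 0 ∧ Tendsto b atTop atTop ∧
    ∀ n t, b n ≤ t → t < b (n + 1) → R t = r n

theorem isStep_const {α : Type*} (c : α) : IsStep fun _ : ℝ => c :=
  ⟨fun n => n, fun _ => c, Nat.strictMono_cast, Nat.cast_zero, tendsto_natCast_atTop_atTop,
    fun _ _ _ _ => rfl⟩

theorem IsStep.map {α β : Type*} {R : ℝ → α} (h : IsStep R) (f : α → β) :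
    IsStep fun t => f (R t) := by
  obtain ⟨b, r, h1, h2, h3, h4⟩ := h
  exact ⟨b, fun n => f (r n), h1, h2, h3, fun n t h h' => congrArg f (h4 n t h h')⟩

/-- Gluing functions defined on consecutive intervals. -/
theorem exists_glue {X X' : ℕ → ℝ → Matrix κ ι ℝ} {b : ℕ → ℝ} (hb : StrictMono b) (hb0 : b 0 = 0)
    (hbt : Tendsto b atTop atTop)
    (hd : ∀ n t a c, HasDerivAt (fun s => X n s a c) (X' n t a c) t)
    (hX : ∀ n, X n (b (n + 1)) = X (n + 1) (b (n + 1))) :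
    ∃ Y Y' : ℝ → Matrix κ ι ℝ, RightDiff Y Y' ∧ Y 0 = X 0 0 ∧
      ∀ t, 0 ≤ t → ∃ n, b n ≤ t ∧ t < b (n + 1) ∧ Y t = X n t ∧ Y' t = X' n t := by
  classical
  have hex : ∀ t : ℝ, ∃ n, t < b (n + 1) := fun t =>
    ((hbt.comp (tendsto_add_atTop_nat 1)).eventually_gt_atTop t).exists
  let N : ℝ → ℕ := fun t => Nat.find (hex t)
  have hN : ∀ n t, b n ≤ t → t < b (n + 1) → N t = n := by
    intro n t h1 h2
    refine (Nat.find_eq_iff _).2 ⟨h2, fun m hm => not_lt.2 ?_⟩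
    exact (hb.monotone (Nat.succ_le_of_lt hm)).trans h1
  have hN2 : ∀ t, 0 ≤ t → b (N t) ≤ t ∧ t < b (N t + 1) := by
    intro t ht
    refine ⟨?_, Nat.find_spec (hex t)⟩
    by_cases h0 : N t = 0
    · rwa [h0, hb0]
    · obtain ⟨m, hm⟩ := Nat.exists_eq_succ_of_ne_zero h0
      rw [hm]
      exact not_lt.1 (Nat.find_min (hex t) (show m < Nat.find (hex t) by
        change m < N t; omega))
  have hY : ∀ n t, b n ≤ t → t ≤ b (n + 1) → X (N t) t = X n t := by
    intro n t h1 h2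
    rcases h2.lt_or_eq with h2 | h2
    · rw [hN n t h1 h2]
    · rw [hN (n + 1) t h2.ge (h2 ▸ hb (Nat.lt_succ_self _)), h2, hX n]
  have hcov : ∀ t : ℝ, 0 ≤ t → t ∈ ⋃ n, Icc (b n) (b (n + 1)) := fun t ht =>
    mem_iUnion.2 ⟨N t, (hN2 t ht).1, (hN2 t ht).2.le⟩
  refine ⟨fun t => X (N t) t, fun t => X' (N t) t, .of_entries (fun a c => ?_) ?_, ?_, ?_⟩
  · refine ContinuousOn.mono ?_ hcov
    refine LocallyFinite.continuousOn_iUnion (fun t => ?_) (fun n => isClosed_Icc) fun n => ?_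
    · obtain ⟨n, hn⟩ := (hbt.eventually_gt_atTop t).exists
      refine ⟨Iio (b n), Iio_mem_nhds hn, (finite_lt_nat n).subset ?_⟩
      rintro k ⟨s, hs1, hs2⟩
      exact hb.lt_iff_lt.1 (hs1.1.trans_lt hs2)
    · refine ContinuousOn.congr (f := fun t => X n t a c)
        (fun t _ => (hd n t a c).continuousAt.continuousWithinAt) fun t ht => ?_
      exact congrFun (congrFun (hY n t ht.1 ht.2) a) c
  · intro t ht a c
    refine (hd (N t) t a c).hasDerivWithinAt.congr_of_eventuallyEq ?_ rfl
    filter_upwards [Ico_mem_nhdsGE (hN2 t ht).2] with s hs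
    simp only [hN (N t) s ((hN2 t ht).1.trans hs.1) hs.2]
  · simp only [hN 0 0 hb0.le (hb0 ▸ hb (Nat.lt_succ_self _))]
  · exact fun t ht => ⟨N t, (hN2 t ht).1, (hN2 t ht).2, rfl, rfl⟩

/-- A linear differential equation with piecewise constant coefficients is solvable. -/
theorem IsStep.exists_linear {H : ℝ → Matrix κ κ ℝ} (hH : IsStep H) (z₀ : Matrix κ ι ℝ) :
    ∃ z, RightDiff z (fun t => H t * z t) ∧ z 0 = z₀ := by
  obtain ⟨b, r, hb, hb0, hbt, hr⟩ := hH
  -- `M n` is the state at the break point `b n`.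
  let M : ℕ → Matrix κ ι ℝ := fun n => Nat.rec z₀
    (fun n M => NormedSpace.exp ((b (n + 1) - b n) • r n) * M) n
  let X : ℕ → ℝ → Matrix κ ι ℝ := fun n t => NormedSpace.exp ((t - b n) • r n) * M n
  have hd : ∀ n t a c, HasDerivAt (fun s => X n s a c) ((r n * X n t) a c) t := by
    intro n t a c
    simp only [X, ← Matrix.mul_assoc]
    simp only [Matrix.mul_apply (N := M n)]
    exact HasDerivAt.fun_sum fun d _ =>
      ((hasDerivAt_exp_smul (r n) (t - b n) a d).comp_sub_const t (b n)).mul_const _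
  obtain ⟨Y, Y', h1, h2, h3⟩ := exists_glue hb hb0 hbt hd fun n => by
    simp [X, M, NormedSpace.exp_zero]
  refine ⟨Y, h1.congr_deriv fun t ht => ?_, by simp [h2, X, M, hb0, NormedSpace.exp_zero]⟩
  obtain ⟨n, hn1, hn2, hY, hY'⟩ := h3 t ht
  rw [hY', hY, hr n t hn1 hn2]

end LinearODE

end Riccati

namespace Riccati

open Matrix Set Filter Topology

/-! ### Riccati flows: comparison, positivity, global existence -/

section Flow

variable {ι : Type*} [Fintype ι] [DecidableEq ι]

theorem psd_symm {M : Matrix ι ι ℝ} (h : M.PosSemidef) : Mᵀ = M := (posSemidef_iff.1 h).1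

theorem psd_quad {M : Matrix ι ι ℝ} (h : M.PosSemidef) (x : ι → ℝ) : 0 ≤ quad M x :=
  (posSemidef_iff.1 h).2 x

theorem psd_mulVec {M : Matrix ι ι ℝ} (h : M.PosSemidef) {x : ι → ℝ} (hx : quad M x = 0) :
    M *ᵥ x = 0 :=
  mulVec_eq_zero_of_quad (psd_symm h) (psd_quad h) hx

theorem pd_symm {M : Matrix ι ι ℝ} (h : M.PosDef) : Mᵀ = M := (posDef_iff.1 h).1

theorem pd_quad {M : Matrix ι ι ℝ} (h : M.PosDef) {x : ι → ℝ} (hx : x ≠ 0) : 0 < quad M x :=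
  (posDef_iff.1 h).2 x hx

theorem quad_conj_symm {M N : Matrix ι ι ℝ} (hN : Nᵀ = N) (x : ι → ℝ) :
    quad (N * M * N) x = quad M (N *ᵥ x) := by
  conv_lhs => rw [← hN]
  rw [← quad_conj]
  simp [hN]

theorem isUnit_of_mulVec {U : Matrix ι ι ℝ} (h : ∀ c, U *ᵥ c = 0 → c = 0) : IsUnit U := by
  rw [← Matrix.mulVec_injective_iff_isUnit]
  intro x y hxy
  have := h (x - y) (by rw [mulVec_sub, hxy, sub_self])
  exact sub_eq_zero.1 this

/-- The Riccati operator. -/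
def ric (A W R X : Matrix ι ι ℝ) : Matrix ι ι ℝ := A * X + X * Aᵀ + W - X * R * X

/-- `X` is a symmetric solution of the Riccati differential equation on `[0, ∞)` and `U` is an
invertible solution of the adjoint of its closed loop. -/
structure IsFlow (A : Matrix ι ι ℝ) (W R X U : ℝ → Matrix ι ι ℝ) : Prop where
  sol : RightDiff X (fun t => ric A (W t) (R t) (X t))
  frame : RightDiff U (fun t => -(Aᵀ - R t * X t) * U t)
  unit : ∀ t, 0 ≤ t → IsUnit (U t)
  symm : ∀ t, 0 ≤ t → (X t)ᵀ = X t

variable {A : Matrix ι ι ℝ} {W R X U Z Z' : ℝ → Matrix ι ι ℝ}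

theorem IsFlow.exists_preimage (h : IsFlow A W R X U) {t : ℝ} (ht : 0 ≤ t) (y : ι → ℝ) :
    ∃ c, U t *ᵥ c = y :=
  ⟨(U t)⁻¹ *ᵥ y, by
    rw [mulVec_mulVec, mul_nonsing_inv _ ((isUnit_iff_isUnit_det _).1 (h.unit t ht)), one_mulVec]⟩

/-- Comparison with a subsolution. -/
theorem IsFlow.ge_of_subsolution (h : IsFlow A W R X U) (hR : ∀ t, 0 ≤ t → (R t).PosSemidef)
    (hZ : RightDiff Z Z') (hZs : ∀ t, 0 ≤ t → (Z t)ᵀ = Z t)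
    (h0 : ∀ x, quad (Z 0) x ≤ quad (X 0) x) {T : ℝ} (hT : 0 ≤ T)
    (hsub : ∀ t, 0 ≤ t → t < T → ∀ x, quad (Z' t) x ≤ quad (ric A (W t) (R t) (Z t)) x)
    (x : ι → ℝ) : quad (Z T) x ≤ quad (X T) x := by
  -- The congruence by the adjoint frame cancels the part linear in `X - Z`. There remain a square
  -- weighted by `R` and the defect of the subsolution, both nonnegative.
  have hE := ((h.frame.transpose.mul (h.sol.sub hZ)).mul h.frame).congr_deriv
    (Y' := fun t => (U t)ᵀ * ((X t - Z t) * R t * (X t - Z t) +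
      (ric A (W t) (R t) (Z t) - Z' t)) * U t) (fun t ht => by
    simp only [transpose_mul, transpose_neg, transpose_sub, transpose_transpose, h.symm t ht,
      psd_symm (hR t ht), ric]
    noncomm_ring)
  obtain ⟨c, rfl⟩ := h.exists_preimage hT x
  have h1 := hE.quad_le c hT fun s hs hsT => by
    rw [quad_conj, quad_add, quad_sub,
      quad_conj_symm (by rw [transpose_sub, h.symm s hs, hZs s hs])]
    have h1 := psd_quad (hR s hs) ((X s - Z s) *ᵥ (U s *ᵥ c))
    have h2 := hsub s hs hsT (U s *ᵥ c)
    linarith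
  simp only [quad_conj, quad_sub] at h1
  have h2 := h0 (U 0 *ᵥ c)
  linarith

/-- Strict positivity at time `T` from observability. -/
theorem IsFlow.posDef_of_observable (h : IsFlow A W R X U)
    (hW : ∀ t, 0 ≤ t → (W t).PosSemidef) (hR : ∀ t, 0 ≤ t → (R t).PosSemidef)
    (h0 : ∀ x, 0 ≤ quad (X 0) x) {T : ℝ} (hT : 0 ≤ T)
    (hobs : ∀ c, (∀ t, 0 ≤ t → t < T → W t *ᵥ (U t *ᵥ c) = 0 ∧
      R t *ᵥ (X t *ᵥ (U t *ᵥ c)) = 0) → c = 0) : (X T).PosDef := by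
  -- The comparison identity with `Z = 0`. If the form vanishes at time `T`, its nonnegative
  -- derivative vanishes on all of `[0, T)`, which is what `hobs` excludes.
  have hE := ((h.frame.transpose.mul h.sol).mul h.frame).congr_deriv
    (Y' := fun t => (U t)ᵀ * (W t + X t * R t * X t) * U t) (fun t ht => by
    simp only [transpose_mul, transpose_neg, transpose_sub, transpose_transpose, h.symm t ht,
      psd_symm (hR t ht), ric]
    noncomm_ring)
  have hnn : ∀ c t, 0 ≤ t → t < T → 0 ≤ quad ((U t)ᵀ * (W t + X t * R t * X t) * U t) c := by
    intro c t ht _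
    rw [quad_conj, quad_add, quad_conj_symm (h.symm t ht)]
    exact add_nonneg (psd_quad (hW t ht) _) (psd_quad (hR t ht) _)
  refine posDef_iff.2 ⟨h.symm T hT, fun x hx => ?_⟩
  obtain ⟨c, rfl⟩ := h.exists_preimage hT x
  have h1 := hE.quad_le c hT (hnn c)
  simp only [quad_conj] at h1
  refine ((h0 _).trans h1).lt_of_ne fun he => hx ?_
  suffices c = 0 by simp [this]
  refine hobs c fun t ht htT => ?_
  have h2 := hE.quad_deriv_eq_zero c (hnn c)
    (by simp only [quad_conj]; rw [← he]; exact h0 _) ht htT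
  rw [quad_conj, quad_add, quad_conj_symm (h.symm t ht)] at h2
  have h3 := psd_quad (hW t ht) (U t *ᵥ c)
  have h4 := psd_quad (hR t ht) (X t *ᵥ (U t *ᵥ c))
  exact ⟨psd_mulVec (hW t ht) (by linarith), psd_mulVec (hR t ht) (by linarith)⟩

/-- Controllability of `(A, W)`: no nonzero vector is annihilated by all `W * Aᵀ ^ j`. -/
def Ctrl (A W : Matrix ι ι ℝ) : Prop := ∀ v, (∀ j : ℕ, W *ᵥ (Aᵀ ^ j *ᵥ v) = 0) → v = 0

/-- Differentiating `W (Aᵀ ^ j (Y t c)) = 0` in `t` gives, up to sign, the same identity for `j +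
1`. -/
theorem Ctrl.eq_zero {A W : Matrix ι ι ℝ} (h : Ctrl A W) {Y Y' : ℝ → Matrix ι ι ℝ}
    (hY : RightDiff Y Y') {c : ι → ℝ} {T : ℝ}
    (h1 : ∀ t, 0 ≤ t → t < T → Y' t *ᵥ c = -(Aᵀ *ᵥ (Y t *ᵥ c)))
    (h2 : ∀ t, 0 ≤ t → t < T → W *ᵥ (Y t *ᵥ c) = 0) {t : ℝ} (ht : 0 ≤ t) (htT : t < T) :
    Y t *ᵥ c = 0 := by
  refine h _ fun j => ?_
  have : ∀ j : ℕ, ∀ t, 0 ≤ t → t < T → W *ᵥ (Aᵀ ^ j *ᵥ (Y t *ᵥ c)) = 0 := by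
    intro j
    induction j with
    | zero => simpa using h2
    | succ j ih =>
      intro t ht htT
      have h3 := (hY.const_mul (W * Aᵀ ^ j)).mulVec_deriv_eq_zero (c := c) (T := T)
        (fun t ht htT => by simpa [← mulVec_mulVec] using ih t ht htT) ht htT
      rw [← mulVec_mulVec, h1 t ht htT, mulVec_neg, neg_eq_zero] at h3
      rw [pow_succ]
      simpa [← mulVec_mulVec] using h3
  exact this j t ht htT

/-- In a degenerate direction `R X U c` vanishes, so `U c` follows the open-loop adjoint equation
while staying in the kernel of `W₀`; controllability rules this out. -/
theorem IsFlow.posDef {W₀ : Matrix ι ι ℝ} (h : IsFlow A (fun _ => W₀) R X U)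
    (hW : W₀.PosSemidef) (hR : ∀ t, 0 ≤ t → (R t).PosSemidef) (hc : Ctrl A W₀)
    (h0 : ∀ x, 0 ≤ quad (X 0) x) {T : ℝ} (hT : 0 < T) : (X T).PosDef := by
  refine h.posDef_of_observable (fun _ _ => hW) hR h0 hT.le fun c hobs => ?_
  have h1 := hc.eq_zero h.frame (c := c) (T := T) (fun t ht htT => by
    have := (hobs t ht htT).2
    rw [← mulVec_mulVec, neg_mulVec, sub_mulVec, ← mulVec_mulVec (M := R t), this, sub_zero])
    (fun t ht htT => (hobs t ht htT).1) le_rfl hT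
  have h2 := (isUnit_iff_isUnit_det _).1 (h.unit 0 le_rfl)
  simpa [mulVec_mulVec, nonsing_inv_mul _ h2] using congrArg (fun v => (U 0)⁻¹ *ᵥ v) h1

/-- The Hamiltonian system attached to a Riccati equation. -/
structure IsHam (A : Matrix ι ι ℝ) (W R V U : ℝ → Matrix ι ι ℝ) : Prop where
  left : RightDiff V (fun t => A * V t + W t * U t)
  right : RightDiff U (fun t => -Aᵀ * U t + R t * V t)

theorem exists_isHam (A : Matrix ι ι ℝ) (hs : IsStep fun t => (W t, R t)) (V₀ U₀ : Matrix ι ι ℝ) :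
    ∃ V U, IsHam A W R V U ∧ V 0 = V₀ ∧ U 0 = U₀ := by
  obtain ⟨z, hz, h0⟩ := (hs.map fun p => fromBlocks A p.1 p.2 (-Aᵀ)).exists_linear (fromRows V₀ U₀)
  refine ⟨fun t => (z t).submatrix Sum.inl id, fun t => (z t).submatrix Sum.inr id,
    ⟨(hz.submatrix Sum.inl id).congr_deriv fun t _ => ?_,
      (hz.submatrix Sum.inr id).congr_deriv fun t _ => ?_⟩, ?_, ?_⟩
  · ext a b; simp [mul_apply]
  · ext a b; simp [mul_apply, add_comm]
  · ext a b; simp [h0]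
  · ext a b; simp [h0]

namespace IsHam

variable {V : ℝ → Matrix ι ι ℝ}

/-- The Hamiltonian flow preserves the symplectic form. This is what makes `V * U⁻¹` symmetric. -/
theorem symm_prod (h : IsHam A W R V U) (hW : ∀ t, 0 ≤ t → (W t).PosSemidef)
    (hR : ∀ t, 0 ≤ t → (R t).PosSemidef) (h0 : (U 0)ᵀ * V 0 = (V 0)ᵀ * U 0) {t : ℝ} (ht : 0 ≤ t) :
    (U t)ᵀ * V t = (V t)ᵀ * U t := by
  have h1 := ((h.right.transpose.mul h.left).sub (h.left.transpose.mul h.right)).congr_deriv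
    (Y' := fun _ => 0) (fun t ht => by
      simp only [transpose_mul, transpose_add, transpose_neg, transpose_transpose,
        psd_symm (hR t ht), psd_symm (hW t ht)]
      noncomm_ring)
  have h2 := h1.const_of_deriv_zero ht
  rw [h0, sub_self] at h2
  exact sub_eq_zero.1 h2

/-- The monotone quantity behind global existence: by `prod_nonneg` the derivative is nonnegative as
a form, and this keeps `U` from becoming singular. -/
theorem prod (h : IsHam A W R V U) (hW : ∀ t, 0 ≤ t → (W t).PosSemidef) :
    RightDiff (fun t => (V t)ᵀ * U t)
      (fun t => (U t)ᵀ * W t * U t + (V t)ᵀ * R t * V t) :=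
  (h.left.transpose.mul h.right).congr_deriv fun t ht => by
    simp only [transpose_mul, transpose_add, psd_symm (hW t ht)]
    noncomm_ring

theorem prod_nonneg (hW : ∀ t, 0 ≤ t → (W t).PosSemidef)
    (hR : ∀ t, 0 ≤ t → (R t).PosSemidef) {t : ℝ} (ht : 0 ≤ t) (c : ι → ℝ) :
    0 ≤ quad ((U t)ᵀ * W t * U t + (V t)ᵀ * R t * V t) c := by
  rw [quad_add, quad_conj, quad_conj]
  exact add_nonneg (psd_quad (hW t ht) _) (psd_quad (hR t ht) _)

/-- Exchanging the halves inverts `V * U⁻¹`, so the inverse of a Riccati solution solves the dual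
equation. -/
theorem swap (h : IsHam A W R V U) : IsHam (-Aᵀ) R W U V where
  left := h.right
  right := h.left.congr_deriv fun t _ => by simp

/-- The quotient of the two halves of a Hamiltonian solution solves the Riccati equation. -/
theorem isFlow (h : IsHam A W R V U) (hW : ∀ t, 0 ≤ t → (W t).PosSemidef)
    (hR : ∀ t, 0 ≤ t → (R t).PosSemidef) (h0 : (U 0)ᵀ * V 0 = (V 0)ᵀ * U 0)
    (hU : ∀ t, 0 ≤ t → IsUnit (U t)) :
    IsFlow A W R (fun t => V t * (U t)⁻¹) U := by
  have hd : ∀ t, 0 ≤ t → IsUnit (U t).det := fun t ht => (isUnit_iff_isUnit_det _).1 (hU t ht)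
  have hV : ∀ t, 0 ≤ t → V t * (U t)⁻¹ * U t = V t := fun t ht =>
    nonsing_inv_mul_cancel_right _ _ (hd t ht)
  refine ⟨(h.left.mul (h.right.inv hU)).congr_deriv fun t ht => ?_,
    h.right.congr_deriv fun t ht => ?_, hU, fun t ht => ?_⟩
  · have h1 : U t * (U t)⁻¹ = 1 := mul_nonsing_inv _ (hd t ht)
    simp only [ric]
    calc _ = A * (V t * (U t)⁻¹) + W t * (U t * (U t)⁻¹) +
          V t * (U t)⁻¹ * Aᵀ * (U t * (U t)⁻¹) - V t * (U t)⁻¹ * R t * (V t * (U t)⁻¹) := by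
          noncomm_ring
      _ = _ := by rw [h1]; noncomm_ring
  · rw [neg_mul, neg_mul, sub_mul, Matrix.mul_assoc (R t), hV t ht]
    abel
  · have h1 := h.symm_prod hW hR h0 ht
    have h2 : ((U t)⁻¹)ᵀ * (U t)ᵀ = 1 := by
      rw [← transpose_mul, mul_nonsing_inv _ (hd t ht), transpose_one]
    rw [transpose_mul]
    calc _ = ((U t)⁻¹)ᵀ * ((V t)ᵀ * U t) * (U t)⁻¹ := by
          rw [Matrix.mul_assoc, Matrix.mul_assoc, mul_nonsing_inv _ (hd t ht), Matrix.mul_one]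
      _ = _ := by
          rw [← h1, ← Matrix.mul_assoc, h2, Matrix.one_mul]

end IsHam

theorem quad_transpose_mul (V U : Matrix ι ι ℝ) (c : ι → ℝ) :
    quad (Vᵀ * U) c = (V *ᵥ c) ⬝ᵥ (U *ᵥ c) := by
  rw [quad_mul, transpose_transpose]

/-- Global existence for the Riccati equation from positive semidefinite initial values. -/
theorem exists_isFlow (A : Matrix ι ι ℝ) (hs : IsStep fun t => (W t, R t))
    (hW : ∀ t, 0 ≤ t → (W t).PosSemidef) (hR : ∀ t, 0 ≤ t → (R t).PosSemidef)
    {X₀ : Matrix ι ι ℝ} (hX₀ : X₀.PosSemidef) :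
    ∃ X U, IsFlow A W R X U ∧ X 0 = X₀ := by
  obtain ⟨V, U, h, hV0, hU0⟩ := exists_isHam A hs X₀ 1
  have h0 : (U 0)ᵀ * V 0 = (V 0)ᵀ * U 0 := by simp [hV0, hU0, psd_symm hX₀]
  refine ⟨_, U, h.isFlow hW hR h0 fun T hT => isUnit_of_mulVec fun c hc => ?_, by
    simp [hV0, hU0]⟩
  -- If `U T c = 0`, the nondecreasing form of `Vᵀ U` at `c` runs from a nonnegative value to zero.
  -- Its derivative therefore vanishes, and with it `R V c`.
  have hN := h.prod hW
  have hN0 : 0 ≤ quad ((V 0)ᵀ * U 0) c := by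
    simpa [hV0, hU0, psd_symm hX₀] using psd_quad hX₀ c
  have h1 : ∀ t, 0 ≤ t → t < T → (-Aᵀ * U t + R t * V t) *ᵥ c = -Aᵀ *ᵥ (U t *ᵥ c) := by
    intro t ht htT
    have h2 := hN.quad_deriv_eq_zero c (fun s hs _ => IsHam.prod_nonneg hW hR hs c)
      (by simpa [quad_transpose_mul, hc] using hN0) ht htT
    rw [quad_add, quad_conj, quad_conj] at h2
    have h3 := psd_quad (hW t ht) (U t *ᵥ c)
    have h4 := psd_quad (hR t ht) (V t *ᵥ c)
    rw [add_mulVec, ← mulVec_mulVec, ← mulVec_mulVec, psd_mulVec (hR t ht) (by linarith), add_zero]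
  -- Then `exp (t Aᵀ) U t c` is constant; it is `0` at `T` and `c` at `0`.
  have h5 := ((rightDiff_exp Aᵀ).mul h.right).mulVec_const (c := c) hT fun t ht htT => by
    rw [add_mulVec, ← mulVec_mulVec _ (NormedSpace.exp _), h1 t ht htT]
    have h6 : Commute Aᵀ (NormedSpace.exp (t • Aᵀ)) :=
      (show Commute Aᵀ (t • Aᵀ) from (Commute.refl _).smul_right t).exp_right
    rw [h6.eq]
    simp [← mulVec_mulVec, neg_mulVec, mulVec_neg]
  rw [← mulVec_mulVec, hc] at h5
  simpa [hU0, NormedSpace.exp_zero] using h5.symm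

/-- Global existence from positive definite initial values, together with the solution of the
dual Riccati equation for the inverse. -/
theorem exists_isFlow_pair (A : Matrix ι ι ℝ) (hs : IsStep fun t => (W t, R t))
    (hW : ∀ t, 0 ≤ t → (W t).PosSemidef) (hR : ∀ t, 0 ≤ t → (R t).PosSemidef)
    {X₀ : Matrix ι ι ℝ} (hX₀ : X₀.PosDef) :
    ∃ X U S V, IsFlow A W R X U ∧ IsFlow (-Aᵀ) R W S V ∧ X 0 = X₀ ∧ S 0 = X₀⁻¹ ∧
      ∀ t, 0 ≤ t → (X t).PosDef ∧ X t * S t = 1 := by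
  obtain ⟨V, U, h, hV0, hU0⟩ := exists_isHam A hs X₀ 1
  have h0 : (U 0)ᵀ * V 0 = (V 0)ᵀ * U 0 := by simp [hV0, hU0, pd_symm hX₀]
  -- The form of `Vᵀ U` starts at `X₀` and does not decrease, so neither `U t` nor `V t` has a
  -- kernel.
  have hN : ∀ t, 0 ≤ t → ∀ c, c ≠ 0 → 0 < (V t *ᵥ c) ⬝ᵥ (U t *ᵥ c) := by
    intro t ht c hc
    rw [← quad_transpose_mul]
    refine lt_of_lt_of_le ?_ ((h.prod hW).quad_le c ht
      fun s hs _ => IsHam.prod_nonneg hW hR hs c)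
    simpa [hV0, hU0, pd_symm hX₀] using pd_quad hX₀ hc
  have hU : ∀ t, 0 ≤ t → IsUnit (U t) := fun t ht => isUnit_of_mulVec fun c hc => by
    by_contra hne
    simpa [hc] using hN t ht c hne
  have hV : ∀ t, 0 ≤ t → IsUnit (V t) := fun t ht => isUnit_of_mulVec fun c hc => by
    by_contra hne
    simpa [hc] using hN t ht c hne
  have hX := h.isFlow hW hR h0 hU
  refine ⟨_, U, _, V, hX, h.swap.isFlow hR hW h0.symm hV, by simp [hV0, hU0],
    by simp [hV0, hU0], fun t ht => ⟨posDef_iff.2 ⟨hX.symm t ht, fun x hx => ?_⟩, ?_⟩⟩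
  · obtain ⟨c, rfl⟩ := hX.exists_preimage ht x
    have hc : c ≠ 0 := by rintro rfl; simp at hx
    have := hN t ht c hc
    rwa [quad, mulVec_mulVec, nonsing_inv_mul_cancel_right _ _ ((isUnit_iff_isUnit_det _).1 (hU t ht)),
      dotProduct_comm]
  · rw [← Matrix.mul_assoc, nonsing_inv_mul_cancel_right _ _ ((isUnit_iff_isUnit_det _).1 (hU t ht)),
      mul_nonsing_inv _ ((isUnit_iff_isUnit_det _).1 (hV t ht))]

end Flow

end Riccati

namespace Riccati

open Matrix Set Filter Topology

/-! ### Quantitative estimates for the order on symmetric matrices -/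

section Order

variable {ι : Type*} [Fintype ι] [DecidableEq ι]

/-- Finsler's lemma. -/
theorem exists_quad_add_mul_ge {M G : Matrix ι ι ℝ} (hG : ∀ x, 0 ≤ quad G x)
    (h : ∀ x, x ≠ 0 → quad G x = 0 → 0 < quad M x) :
    ∃ k : ℝ, 0 ≤ k ∧ ∃ c > 0, ∀ x, c * ‖x‖ ^ 2 ≤ quad M x + k * quad G x := by
  -- These open sets increase with `k` and cover the unit sphere, so by compactness a single `k`
  -- serves both as multiplier and, through `1 / (k + 1)`, as lower bound.
  let O : ℕ → Set (ι → ℝ) := fun k => {x | 1 / ((k : ℝ) + 1) < quad M x + k * quad G x}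
  have hO : ∀ k, IsOpen (O k) := fun k => isOpen_lt continuous_const
    ((continuous_quad M).add ((continuous_quad G).const_mul _))
  have hmono : Monotone O := by
    intro j k hjk x hx
    have hjk' : (j : ℝ) ≤ k := by exact_mod_cast hjk
    simp only [O, mem_ofPred_eq] at hx ⊢
    refine lt_of_le_of_lt ?_ (lt_of_lt_of_le hx ?_)
    · exact one_div_le_one_div_of_le (by positivity) (by linarith)
    · have := mul_le_mul_of_nonneg_right hjk' (hG x)
      linarith
  obtain ⟨k, hk⟩ := (isCompact_sphere (0 : ι → ℝ) 1).elim_directed_cover O hO (by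
    intro x hx
    have hx1 : ‖x‖ = 1 := by simpa using hx
    have hx0 : x ≠ 0 := by rintro rfl; simp at hx1
    rw [mem_iUnion]
    rcases (hG x).eq_or_lt with h0 | h0
    · obtain ⟨n, hn⟩ := exists_nat_one_div_lt (h x hx0 h0.symm)
      exact ⟨n, by simpa [O, ← h0] using hn⟩
    · obtain ⟨n, hn⟩ := exists_nat_gt ((1 - quad M x) / quad G x)
      refine ⟨n, ?_⟩
      rw [div_lt_iff₀ h0] at hn
      have : 1 / ((n : ℝ) + 1) ≤ 1 := by
        rw [div_le_one (by positivity)]; linarith [n.cast_nonneg (α := ℝ)]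
      simp only [O, mem_ofPred_eq]
      linarith) (directed_of_isDirected_le hmono)
  refine ⟨k, k.cast_nonneg, 1 / ((k : ℝ) + 1), by positivity, fun x => ?_⟩
  rcases eq_or_ne x 0 with rfl | hx
  · simp
  have hx' : 0 < ‖x‖ := norm_pos_iff.2 hx
  have h1 : ‖x‖⁻¹ • x ∈ O k := hk (by simp [norm_smul, hx'.ne'])
  have h2 : 1 / ((k : ℝ) + 1) < ‖x‖⁻¹ ^ 2 * (quad M x + k * quad G x) := by
    have : 1 / ((k : ℝ) + 1) < quad M (‖x‖⁻¹ • x) + k * quad G (‖x‖⁻¹ • x) := h1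
    rw [quad_smul_right, quad_smul_right] at this
    linarith
  have h3 := mul_le_mul_of_nonneg_right h2.le (sq_nonneg ‖x‖)
  refine h3.trans_eq ?_
  field_simp

theorem exists_quad_ge {S : Matrix ι ι ℝ} (hS : S.PosDef) :
    ∃ c > 0, ∀ x, c * ‖x‖ ^ 2 ≤ quad S x := by
  obtain ⟨k, -, c, hc, h⟩ := exists_quad_add_mul_ge (M := S) (G := 0) (by simp)
    fun x hx _ => pd_quad hS hx
  exact ⟨c, hc, by simpa using h⟩

theorem abs_quad_le {M : Matrix ι ι ℝ} {r : ℝ} (hr : ∀ a b, |M a b| ≤ r) (x : ι → ℝ) :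
    |quad M x| ≤ (Fintype.card ι) ^ 2 * r * ‖x‖ ^ 2 := by
  have h1 : quad M x = ∑ a, ∑ b, x a * (M a b * x b) := by
    simp [quad, dotProduct, mulVec, Finset.mul_sum]
  have h2 : ∀ a b, |x a * (M a b * x b)| ≤ r * ‖x‖ ^ 2 := by
    intro a b
    have ha := norm_le_pi_norm x a
    have hb := norm_le_pi_norm x b
    have h0 : 0 ≤ r := (abs_nonneg _).trans (hr a b)
    rw [Real.norm_eq_abs] at ha hb
    calc |x a * (M a b * x b)| = |M a b| * (|x a| * |x b|) := by rw [abs_mul, abs_mul]; ring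
      _ ≤ r * (‖x‖ * ‖x‖) := by gcongr; exact hr a b
      _ = _ := by ring
  rw [h1]
  calc _ ≤ ∑ a, ∑ b, |x a * (M a b * x b)| :=
        (Finset.abs_sum_le_sum_abs _ _).trans
          (Finset.sum_le_sum fun a _ => Finset.abs_sum_le_sum_abs _ _)
    _ ≤ ∑ _a : ι, ∑ _b : ι, r * ‖x‖ ^ 2 :=
        Finset.sum_le_sum fun a _ => Finset.sum_le_sum fun b _ => h2 a b
    _ = _ := by simp; ring

/-- Entrywise bounds give bounds relative to a positive definite matrix. -/
theorem exists_abs_quad_le {S : Matrix ι ι ℝ} (hS : S.PosDef) :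
    ∃ C > 0, ∀ (M : Matrix ι ι ℝ) (r : ℝ), 0 ≤ r → (∀ a b, |M a b| ≤ r) →
      ∀ x, |quad M x| ≤ C * r * quad S x := by
  obtain ⟨c, hc, h⟩ := exists_quad_ge hS
  refine ⟨(Fintype.card ι ^ 2 + 1) / c, by positivity, fun M r hr hM x => ?_⟩
  refine (abs_quad_le hM x).trans ?_
  have h1 : ‖x‖ ^ 2 ≤ quad S x / c := by rw [le_div_iff₀ hc]; linarith [h x]
  calc _ ≤ (Fintype.card ι ^ 2 + 1) * r * (quad S x / c) := by gcongr; linarith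
    _ = _ := by ring

theorem quad_single_add (M : Matrix ι ι ℝ) (hM : Mᵀ = M) (a b : ι) :
    4 * M a b = quad M (Pi.single a 1 + Pi.single b 1) - quad M (Pi.single a 1 - Pi.single b 1) := by
  rw [quad_add_right _ _ hM, quad_sub_right _ _ hM]
  simp only [mulVec_single_one, single_dotProduct, col_apply, one_mul]
  ring

theorem quad_single (M : Matrix ι ι ℝ) (a : ι) : quad M (Pi.single a 1) = M a a := by
  simp [quad]

/-- Bounds relative to a symmetric matrix give entrywise bounds. -/
theorem abs_entry_le {M S : Matrix ι ι ℝ} (hM : Mᵀ = M) (hS : Sᵀ = S) {r : ℝ}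
    (h : ∀ x, |quad M x| ≤ r * quad S x) (a b : ι) : |M a b| ≤ r * ((S a a + S b b) / 2) := by
  have h1 := quad_single_add M hM a b
  have h2 := h (Pi.single a 1 + Pi.single b 1)
  have h3 := h (Pi.single a 1 - Pi.single b 1)
  rw [quad_add_right _ _ hS, quad_single, quad_single] at h2
  rw [quad_sub_right _ _ hS, quad_single, quad_single] at h3
  rw [abs_le] at *
  constructor <;> linarith

theorem ext_quad {M N : Matrix ι ι ℝ} (hM : Mᵀ = M) (hN : Nᵀ = N)
    (h : ∀ x, quad M x = quad N x) : M = N := by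
  ext a b
  have h1 := quad_single_add M hM a b
  have h2 := quad_single_add N hN a b
  rw [h, h] at h1
  linarith

/-- Expand `0 ≤ quad Sb (Xa y - Xb y)` and replace `Sb` by the larger `Sa` in the first term. -/
theorem quad_inv_le {Sa Sb Xa Xb : Matrix ι ι ℝ} (hb : Sb.PosDef)
    (hXa : Xa * Sa = 1) (hXb : Xb * Sb = 1) (h : ∀ x, quad Sb x ≤ quad Sa x) (y : ι → ℝ) :
    quad Xa y ≤ quad Xb y := by
  have h1 : Sa *ᵥ (Xa *ᵥ y) = y := by rw [mulVec_mulVec, mul_eq_one_comm.1 hXa, one_mulVec]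
  have h2 : Sb *ᵥ (Xb *ᵥ y) = y := by rw [mulVec_mulVec, mul_eq_one_comm.1 hXb, one_mulVec]
  have h3 := psd_quad hb.posSemidef (Xa *ᵥ y - Xb *ᵥ y)
  rw [quad_sub_right _ _ (pd_symm hb), h2] at h3
  have h4 : quad Sb (Xb *ᵥ y) = quad Xb y := by rw [quad, h2, quad, dotProduct_comm]
  have h5 : quad Sa (Xa *ᵥ y) = quad Xa y := by rw [quad, h1, quad, dotProduct_comm]
  have h6 : (Xa *ᵥ y) ⬝ᵥ y = quad Xa y := by rw [quad, dotProduct_comm]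
  linarith [h (Xa *ᵥ y)]

/-- The bound `c ≤ 1` allows `c` to be used as a weight in convex combinations. -/
theorem exists_smul_quad_le {M S : Matrix ι ι ℝ} (hS : S.PosDef) :
    ∃ c > 0, c ≤ 1 ∧ ∀ x, c * quad M x ≤ quad S x := by
  obtain ⟨C, hC, h⟩ := exists_abs_quad_le hS
  obtain ⟨r, hr⟩ : ∃ r, ∀ a b, |M a b| ≤ r := by
    refine ⟨∑ a, ∑ b, |M a b|, fun a b => ?_⟩
    exact (Finset.single_le_sum (f := fun b => |M a b|) (fun _ _ => abs_nonneg _)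
      (Finset.mem_univ b)).trans (Finset.single_le_sum (f := fun a => ∑ b, |M a b|)
      (fun _ _ => Finset.sum_nonneg fun _ _ => abs_nonneg _) (Finset.mem_univ a))
  have h1 := h M (max r 0) (le_max_right _ _) fun a b => (hr a b).trans (le_max_left _ _)
  have h0 : 0 < C * max r 0 + 1 := by positivity
  refine ⟨1 / (C * max r 0 + 1), by positivity, ?_, fun x => ?_⟩
  · rw [div_le_one h0]
    have : 0 ≤ C * max r 0 := by positivity
    linarith
  · rw [one_div, inv_mul_le_iff₀ h0]
    linarith [le_of_abs_le (h1 x), psd_quad hS.posSemidef x]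

theorem exists_entry_bound {X : ℝ → Matrix ι ι ℝ} {T : ℝ} (hX : ContinuousOn X (Ici 0)) :
    ∃ r, 0 ≤ r ∧ ∀ t, 0 ≤ t → t ≤ T → ∀ a b, |X t a b| ≤ r := by
  have h1 : ∀ a b, ∃ r, ∀ t ∈ Icc 0 T, |X t a b| ≤ r := fun a b => by
    obtain ⟨r, hr⟩ := isCompact_Icc.exists_bound_of_continuousOn
      ((continuousOn_matrix_iff.1 hX a b).mono (Icc_subset_Ici_self : Icc 0 T ⊆ _))
    exact ⟨r, hr⟩
  choose r hr using h1
  have hr0 : ∀ a b, r a b ≤ ∑ a, ∑ b, |r a b| := fun a b => (le_abs_self _).trans <|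
    (Finset.single_le_sum (f := fun b => |r a b|) (fun _ _ => abs_nonneg _)
      (Finset.mem_univ b)).trans (Finset.single_le_sum (f := fun a => ∑ b, |r a b|)
      (fun _ _ => Finset.sum_nonneg fun _ _ => abs_nonneg _) (Finset.mem_univ a))
  exact ⟨∑ a, ∑ b, |r a b|, Finset.sum_nonneg fun _ _ => Finset.sum_nonneg fun _ _ => abs_nonneg _,
    fun t h0 hT a b => (hr a b t ⟨h0, hT⟩).trans (hr0 a b)⟩

/-- A sequence of symmetric matrices that decreases and is bounded below converges. -/
theorem exists_limit_of_antitone {X : ℕ → Matrix ι ι ℝ} (hX : ∀ n, (X n)ᵀ = X n)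
    (hmono : ∀ n x, quad (X (n + 1)) x ≤ quad (X n) x) (hb : ∀ n x, 0 ≤ quad (X n) x) :
    ∃ Y, Yᵀ = Y ∧ (∀ a b, Tendsto (fun n => X n a b) atTop (𝓝 (Y a b))) ∧
      ∀ x, Tendsto (fun n => quad (X n) x) atTop (𝓝 (quad Y x)) := by
  have h1 : ∀ x, ∃ l, Tendsto (fun n => quad (X n) x) atTop (𝓝 l) := fun x =>
    ⟨_, tendsto_atTop_ciInf (antitone_nat_of_succ_le fun n => hmono n x)
      ⟨0, by rintro _ ⟨n, rfl⟩; exact hb n x⟩⟩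
  choose l hl using h1
  let Y : Matrix ι ι ℝ := of fun a b =>
    (l (Pi.single a 1 + Pi.single b 1) - l (Pi.single a 1 - Pi.single b 1)) / 4
  have h2 : ∀ a b, Tendsto (fun n => X n a b) atTop (𝓝 (Y a b)) := fun a b => by
    refine (((hl (Pi.single a 1 + Pi.single b 1)).sub
      (hl (Pi.single a 1 - Pi.single b 1))).div_const 4).congr fun n => ?_
    rw [← quad_single_add _ (hX n)]
    ring
  refine ⟨Y, ?_, h2, fun x => ?_⟩
  · ext a b
    refine tendsto_nhds_unique (h2 b a) ((h2 a b).congr fun n => ?_)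
    exact congrFun (congrFun (hX n) b) a
  · simp only [quad, dotProduct, mulVec]
    exact tendsto_finsetSum _ fun a _ => tendsto_const_nhds.mul <|
      tendsto_finsetSum _ fun b _ => (h2 a b).mul_const _

end Order

/-! ### Uniqueness, monotonicity and concavity of the flow -/

section Uniqueness

variable {ι : Type*} [Fintype ι] [DecidableEq ι]
variable {A : Matrix ι ι ℝ} {W R X U Z Z' Y V : ℝ → Matrix ι ι ℝ}

section Normed

attribute [local instance] Matrix.linftyOpNormedRing Matrix.linftyOpNormedAlgebra

/-- Uniqueness for the Riccati differential equation. -/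
theorem IsFlow.eq_of_sol (h : IsFlow A W R X U) (hs : IsStep R)
    (hY : RightDiff Y (fun t => ric A (W t) (R t) (Y t))) (h0 : Y 0 = X 0) {T : ℝ} (hT : 0 ≤ T) :
    Y T = X T := by
  -- `Y` is not assumed symmetric, so comparison does not apply. Multiplied by the frame, the
  -- difference solves a homogeneous linear equation, and a Grönwall estimate finishes because `R`
  -- is bounded on `[0, T)`.
  have hE := ((hY.sub h.sol).mul h.frame).congr_deriv
    (Y' := fun t => (A - Y t * R t) * ((Y t - X t) * U t)) (fun t ht => by
    simp only [ric]
    noncomm_ring)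
  obtain ⟨B, hB⟩ : ∃ B, ∀ t ∈ Ico 0 T, ‖R t‖ ≤ B := by
    obtain ⟨b, r, hb, hb0, hbt, hr⟩ := hs
    obtain ⟨n, hn⟩ := (hbt.eventually_gt_atTop T).exists
    refine ⟨∑ k ∈ Finset.range n, ‖r k‖, ?_⟩
    have key : ∀ m t, 0 ≤ t → t < b m → ‖R t‖ ≤ ∑ k ∈ Finset.range m, ‖r k‖ := by
      intro m
      induction m with
      | zero => intro t h0 h1; rw [hb0] at h1; linarith
      | succ m ih =>
        intro t h0 h1
        rw [Finset.sum_range_succ]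
        rcases lt_or_ge t (b m) with h2 | h2
        · linarith [ih t h0 h2, norm_nonneg (r m)]
        · rw [hr m t h2 h1]
          linarith [Finset.sum_nonneg fun k (_ : k ∈ Finset.range m) => norm_nonneg (r k)]
    exact fun t ht => key n t ht.1 (ht.2.trans hn)
  obtain ⟨K, hK⟩ := isCompact_Icc.exists_bound_of_continuousOn
    (hY.cont.mono (Icc_subset_Ici_self : Icc 0 T ⊆ _))
  have h1 := eq_zero_of_abs_deriv_le_mul_abs_self_of_eq_zero_right (K := ‖A‖ + K * B)
    (f := fun t => (Y t - X t) * U t)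
    (f' := fun t => (A - Y t * R t) * ((Y t - X t) * U t))
    (hE.cont.mono (Icc_subset_Ici_self : Icc 0 T ⊆ _))
    (fun _ ht => hasDerivWithinAt_matrix_iff.2 (hE.deriv _ ht.1)) (by simp [h0]) (fun _ ht => by
      refine (norm_mul_le _ _).trans ?_
      gcongr
      refine (norm_sub_le _ _).trans ?_
      gcongr
      exact (norm_mul_le _ _).trans (mul_le_mul (hK _ (Ico_subset_Icc_self ht)) (hB _ ht)
        (norm_nonneg _) ((norm_nonneg _).trans (hK _ (Ico_subset_Icc_self ht))))) T ⟨hT, le_rfl⟩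
  have h2 := congrArg (· * (U T)⁻¹) h1
  simp only [zero_mul] at h2
  rw [mul_nonsing_inv_cancel_right _ _ ((isUnit_iff_isUnit_det _).1 (h.unit T hT))] at h2
  exact sub_eq_zero.1 h2

end Normed

theorem IsFlow.shift (h : IsFlow A W R X U) {c : ℝ} (hc : 0 ≤ c) :
    IsFlow A (fun t => W (t + c)) (fun t => R (t + c)) (fun t => X (t + c)) (fun t => U (t + c)) :=
  ⟨h.sol.comp_add hc, h.frame.comp_add hc, fun _ ht => h.unit _ (add_nonneg ht hc),
    fun _ ht => h.symm _ (add_nonneg ht hc)⟩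

theorem IsFlow.shift_periodic {W₀ : Matrix ι ι ℝ} (h : IsFlow A (fun _ => W₀) R X U) {T : ℝ}
    (hT : 0 ≤ T) (hR : Function.Periodic R T) (n : ℕ) :
    IsFlow A (fun _ => W₀) R (fun t => X (t + n * T)) (fun t => U (t + n * T)) := by
  have h1 := h.shift (mul_nonneg n.cast_nonneg hT : 0 ≤ (n : ℝ) * T)
  rwa [show (fun t => R (t + n * T)) = R from funext (hR.nat_mul n)] at h1

theorem IsFlow.mono (hX : IsFlow A W R X U) (hY : IsFlow A W R Y V)
    (hR : ∀ t, 0 ≤ t → (R t).PosSemidef) (h0 : ∀ x, quad (Y 0) x ≤ quad (X 0) x)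
    {t : ℝ} (ht : 0 ≤ t) (x : ι → ℝ) : quad (Y t) x ≤ quad (X t) x :=
  hX.ge_of_subsolution hR hY.sol hY.symm h0 ht (fun _ _ _ _ => le_rfl) x

theorem IsFlow.unique (hX : IsFlow A W R X U) (hY : IsFlow A W R Y V)
    (hR : ∀ t, 0 ≤ t → (R t).PosSemidef) (h0 : X 0 = Y 0) {t : ℝ} (ht : 0 ≤ t) : X t = Y t :=
  ext_quad (hX.symm t ht) (hY.symm t ht) fun x => le_antisymm
    (hY.mono hX hR (fun x => by rw [h0]) ht x) (hX.mono hY hR (fun x => by rw [h0]) ht x)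

/-- Concavity of the Riccati flow. -/
theorem IsFlow.concave {O V' : ℝ → Matrix ι ι ℝ} (hX : IsFlow A W R X U) (hY : IsFlow A W R Y V)
    (hO : IsFlow A W R O V') (hR : ∀ t, 0 ≤ t → (R t).PosSemidef) {c : ℝ} (hc : 0 ≤ c) (hc1 : c ≤ 1)
    (h0 : ∀ x, c * quad (Y 0) x + (1 - c) * quad (O 0) x ≤ quad (X 0) x)
    {t : ℝ} (ht : 0 ≤ t) (x : ι → ℝ) :
    c * quad (Y t) x + (1 - c) * quad (O t) x ≤ quad (X t) x := by
  have h1 := hX.ge_of_subsolution hR ((hY.sol.smul c).add (hO.sol.smul (1 - c)))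
    (fun _ ht => by rw [transpose_add, transpose_smul, transpose_smul, hY.symm _ ht, hO.symm _ ht])
    (by simpa using h0) ht (fun t ht _ x => ?_) x
  · simpa using h1
  · have h2 : ric A (W t) (R t) (c • Y t + (1 - c) • O t) =
        c • ric A (W t) (R t) (Y t) + (1 - c) • ric A (W t) (R t) (O t) +
        (c * (1 - c)) • ((Y t - O t) * R t * (Y t - O t)) := by
      simp only [ric, Matrix.mul_add, Matrix.add_mul, Matrix.mul_sub, Matrix.sub_mul,
        Matrix.smul_mul, Matrix.mul_smul]
      module
    rw [h2, quad_add _ ((c * (1 - c)) • _), quad_smul,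
      quad_conj_symm (by rw [transpose_sub, hY.symm t ht, hO.symm t ht])]
    have h3 := mul_nonneg (mul_nonneg hc (sub_nonneg.2 hc1))
      (psd_quad (hR t ht) ((Y t - O t) *ᵥ x))
    linarith

end Uniqueness

end Riccati

namespace Riccati

open Matrix Set Filter Topology

/-! ### Contraction and periodic solutions -/

section Periodic

variable {ι : Type*} [Fintype ι] [DecidableEq ι]

/-- The data of a controllable Riccati equation whose information matrix is periodic. -/
structure PeriodicSystem (A W : Matrix ι ι ℝ) (R : ℝ → Matrix ι ι ℝ) (T : ℝ) : Prop where
  W_psd : W.PosSemidef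
  ctrl : Ctrl A W
  R_psd : ∀ t, 0 ≤ t → (R t).PosSemidef
  R_step : IsStep R
  pos : 0 < T
  periodic : Function.Periodic R T

/-- Some positive definite initial value does not increase over one period. -/
def HasSuper (A W : Matrix ι ι ℝ) (R : ℝ → Matrix ι ι ℝ) (T : ℝ) : Prop :=
  ∃ Z U, IsFlow A (fun _ => W) R Z U ∧ (Z 0).PosDef ∧ ∀ x, quad (Z T) x ≤ quad (Z 0) x

namespace PeriodicSystem

variable {A W : Matrix ι ι ℝ} {R : ℝ → Matrix ι ι ℝ} {T : ℝ}
  {X U Y V O V' : ℝ → Matrix ι ι ℝ}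

theorem exists_flow (h : PeriodicSystem A W R T) {X₀ : Matrix ι ι ℝ} (h0 : X₀.PosSemidef) :
    ∃ X U, IsFlow A (fun _ => W) R X U ∧ X 0 = X₀ :=
  exists_isFlow A (h.R_step.map fun r => (W, r)) (fun _ _ => h.W_psd) h.R_psd h0

theorem flow_nonneg (h : PeriodicSystem A W R T) (hX : IsFlow A (fun _ => W) R X U)
    (h0 : ∀ x, 0 ≤ quad (X 0) x) {t : ℝ} (ht : 0 ≤ t) (x : ι → ℝ) : 0 ≤ quad (X t) x := by
  rcases ht.eq_or_lt with rfl | ht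
  · exact h0 x
  · exact psd_quad (hX.posDef h.W_psd h.R_psd h.ctrl h0 ht).posSemidef x

/-- Concavity with the solution from zero as the other endpoint; that solution is nonnegative and
can be dropped. -/
theorem scale (h : PeriodicSystem A W R T) (hX : IsFlow A (fun _ => W) R X U)
    (hY : IsFlow A (fun _ => W) R Y V) {c : ℝ} (hc : 0 ≤ c) (hc1 : c ≤ 1)
    (h0 : ∀ x, c * quad (Y 0) x ≤ quad (X 0) x) {t : ℝ} (ht : 0 ≤ t) (x : ι → ℝ) :
    c * quad (Y t) x ≤ quad (X t) x := by
  obtain ⟨O, V', hO, hO0⟩ := h.exists_flow PosSemidef.zero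
  have h1 := hX.concave hY hO h.R_psd hc hc1 (fun x => by simpa [hO0] using h0 x) ht x
  have h2 := h.flow_nonneg hO (fun x => by simp [hO0]) ht x
  nlinarith [mul_nonneg (sub_nonneg.2 hc1) h2]

/-- By monotonicity the solution `Z` of `HasSuper` stays below `Z 0` at all multiples of `T`, hence
later periods lie below the first one. Any other solution is compared with `Z` through `scale`. -/
theorem exists_bound (h : PeriodicSystem A W R T) (hs : HasSuper A W R T)
    (hX : IsFlow A (fun _ => W) R X U) :
    ∃ B : Matrix ι ι ℝ, B.PosDef ∧ ∀ t, 0 ≤ t → ∀ x, quad (X t) x ≤ quad B x := by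
  obtain ⟨Z, U', hZ, hZ0, hZT⟩ := hs
  obtain ⟨C, hC, hCb⟩ := exists_abs_quad_le (S := (1 : Matrix ι ι ℝ)) PosDef.one
  obtain ⟨r, hr, hrb⟩ := exists_entry_bound (T := T) hZ.sol.cont
  obtain ⟨c, hc, hc1, hcX⟩ := exists_smul_quad_le (M := X 0) hZ0
  have h1 : ∀ n : ℕ, ∀ x, quad (Z (n * T)) x ≤ quad (Z 0) x := by
    intro n
    induction n with
    | zero => simp
    | succ n ih =>
      intro x
      have h2 := hZ.mono (hZ.shift_periodic h.pos.le h.periodic n) h.R_psd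
        (fun x => by simpa using ih x) h.pos.le x
      rw [show ((n + 1 : ℕ) : ℝ) * T = T + n * T by push_cast; ring]
      exact h2.trans (hZT x)
  have h2 : ∀ t, 0 ≤ t → ∀ x, quad (Z t) x ≤ C * r * quad 1 x := by
    intro t ht x
    have h3 := Nat.floor_le (div_nonneg ht h.pos.le)
    have h4 := Nat.lt_floor_add_one (t / T)
    rw [le_div_iff₀ h.pos] at h3
    rw [div_lt_iff₀ h.pos] at h4
    set n := ⌊t / T⌋₊
    have h5 : 0 ≤ t - n * T := by linarith
    have h6 := hZ.mono (hZ.shift_periodic h.pos.le h.periodic n) h.R_psd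
        (fun x => by simpa using h1 n x) h5 x
    rw [sub_add_cancel] at h6
    exact h6.trans (le_of_abs_le (hCb _ r hr (hrb _ h5 (by linarith)) x))
  refine ⟨((C * r + 1) / c) • 1, PosDef.one.smul (by positivity), fun t ht x => ?_⟩
  have h3 := (h.scale hZ hX hc.le hc1 hcX ht x).trans (h2 t ht x)
  have h4 := psd_quad (PosDef.one (n := ι) (R := ℝ)).posSemidef x
  rw [quad_smul, div_mul_eq_mul_div, le_div_iff₀ hc]
  linarith

/-- The distance to `1` of the ratio of two solutions contracts at every period. -/
theorem contract (h : PeriodicSystem A W R T) (hX : IsFlow A (fun _ => W) R X U)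
    (hY : IsFlow A (fun _ => W) R Y V) (hO : IsFlow A (fun _ => W) R O V') (hO0 : O 0 = 0)
    {c : ℝ} (hc : 0 ≤ c) (hc1 : c ≤ 1) (hcY : ∀ t, 0 ≤ t → ∀ x, c * quad (Y t) x ≤ quad (O T) x)
    {g : ℝ} (hg : 0 ≤ g) (hg1 : g ≤ 1) (h0 : ∀ x, g * quad (Y 0) x ≤ quad (X 0) x) (n : ℕ) :
    ∀ t, n * T ≤ t → ∀ x, (1 - (1 - g) * (1 - c) ^ n) * quad (Y t) x ≤ quad (X t) x := by
  have hfac : ∀ n : ℕ, 0 ≤ (1 - g) * (1 - c) ^ n ∧ (1 - g) * (1 - c) ^ n ≤ 1 := fun n =>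
    ⟨mul_nonneg (by linarith) (pow_nonneg (by linarith) n),
      mul_le_one₀ (by linarith) (pow_nonneg (by linarith) n)
        (pow_le_one₀ (by linarith) (by linarith))⟩
  have key : ∀ x, (1 - (1 - g) * (1 - c) ^ n) * quad (Y (n * T)) x ≤ quad (X (n * T)) x := by
    induction n with
    | zero => simpa using h0
    | succ n ih =>
      intro x
      -- With ratio `γ` at the start of a period, concavity gives `X ≥ γ Y + (1 - γ) O T` at its
      -- end, and `O T ≥ c Y` raises the ratio to `γ + (1 - γ) c`. Thus `1 - γ` is multiplied by `1
      -- - c`.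
      have h1 := (hX.shift_periodic h.pos.le h.periodic n).concave
        (hY.shift_periodic h.pos.le h.periodic n) hO h.R_psd
        (c := 1 - (1 - g) * (1 - c) ^ n) (by linarith [(hfac n).2]) (by linarith [(hfac n).1])
        (fun x => by simpa [hO0] using ih x) h.pos.le x
      rw [show ((n + 1 : ℕ) : ℝ) * T = T + n * T by push_cast; ring]
      have h2 := hcY (T + n * T) (by have := h.pos; positivity) x
      refine le_trans ?_ h1
      have h3 := mul_le_mul_of_nonneg_left h2 (hfac n).1
      rw [pow_succ]
      linarith
  intro t ht x
  have h1 := h.scale (hX.shift_periodic h.pos.le h.periodic n)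
    (hY.shift_periodic h.pos.le h.periodic n)
    (c := 1 - (1 - g) * (1 - c) ^ n) (by linarith [(hfac n).2])
    (by linarith [(hfac n).1]) (fun x => by simpa using key x) (sub_nonneg.2 ht) x
  simpa using h1

theorem exists_zero_flow (h : PeriodicSystem A W R T) :
    ∃ O V', IsFlow A (fun _ => W) R O V' ∧ O 0 = 0 ∧ (O T).PosDef := by
  obtain ⟨O, V', hO, hO0⟩ := h.exists_flow PosSemidef.zero
  exact ⟨O, V', hO, hO0, hO.posDef h.W_psd h.R_psd h.ctrl (fun x => by simp [hO0]) h.pos⟩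

/-- Any two solutions with positive definite initial values approach each other. -/
theorem tendsto_sub (h : PeriodicSystem A W R T) (hs : HasSuper A W R T)
    (hX : IsFlow A (fun _ => W) R X U) (hX0 : (X 0).PosDef)
    (hY : IsFlow A (fun _ => W) R Y V) (hY0 : (Y 0).PosDef) :
    Tendsto (fun t => X t - Y t) atTop (𝓝 0) := by
  obtain ⟨O, V', hO, hO0, hOT⟩ := h.exists_zero_flow
  obtain ⟨B₁, hB₁, hXB⟩ := h.exists_bound hs hX
  obtain ⟨B₂, hB₂, hYB⟩ := h.exists_bound hs hY
  obtain ⟨g₁, hg₁, hg₁', hgX⟩ := exists_smul_quad_le (M := X 0) hY0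
  obtain ⟨g₂, hg₂, hg₂', hgY⟩ := exists_smul_quad_le (M := Y 0) hX0
  obtain ⟨c₁, hc₁, hc₁', hcX⟩ := exists_smul_quad_le (M := B₁) hOT
  obtain ⟨c₂, hc₂, hc₂', hcY⟩ := exists_smul_quad_le (M := B₂) hOT
  have k1 := h.contract hY hX hO hO0 hc₁.le hc₁' (fun t ht x =>
    (mul_le_mul_of_nonneg_left (hXB t ht x) hc₁.le).trans (hcX x)) hg₁.le hg₁' hgX
  have k2 := h.contract hX hY hO hO0 hc₂.le hc₂' (fun t ht x =>
    (mul_le_mul_of_nonneg_left (hYB t ht x) hc₂.le).trans (hcY x)) hg₂.le hg₂' hgY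
  let S := B₁ + B₂
  let e : ℕ → ℝ := fun n => (1 - g₁) * (1 - c₁) ^ n + (1 - g₂) * (1 - c₂) ^ n
  have he : Tendsto e atTop (𝓝 0) := by
    have h1 : Tendsto (fun n : ℕ => (1 - c₁) ^ n) atTop (𝓝 0) :=
      tendsto_pow_atTop_nhds_zero_of_lt_one (by linarith) (by linarith)
    have h2 : Tendsto (fun n : ℕ => (1 - c₂) ^ n) atTop (𝓝 0) :=
      tendsto_pow_atTop_nhds_zero_of_lt_one (by linarith) (by linarith)
    simpa using (h1.const_mul (1 - g₁)).add (h2.const_mul (1 - g₂))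
  have hb : ∀ n : ℕ, ∀ t, n * T ≤ t → ∀ a b, |(X t - Y t) a b| ≤ e n * ((S a a + S b b) / 2) := by
    intro n t ht
    have ht0 : 0 ≤ t := le_trans (by have := h.pos; positivity) ht
    refine abs_entry_le (by rw [transpose_sub, hX.symm t ht0, hY.symm t ht0])
      (by simp [S, pd_symm hB₁, pd_symm hB₂]) fun x => ?_
    have h1 := k1 n t ht x
    have h2 := k2 n t ht x
    have e1 : 0 ≤ (1 - g₁) * (1 - c₁) ^ n :=
      mul_nonneg (by linarith) (pow_nonneg (by linarith) n)
    have e2 : 0 ≤ (1 - g₂) * (1 - c₂) ^ n :=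
      mul_nonneg (by linarith) (pow_nonneg (by linarith) n)
    have p1 := psd_quad hB₁.posSemidef x
    have p2 := psd_quad hB₂.posSemidef x
    have q1 := mul_le_mul_of_nonneg_left (hXB t ht0 x) e1
    have q2 := mul_le_mul_of_nonneg_left (hYB t ht0 x) e2
    have m1 := mul_nonneg e1 p1
    have m2 := mul_nonneg e1 p2
    have m3 := mul_nonneg e2 p1
    have m4 := mul_nonneg e2 p2
    simp only [S, e, quad_sub, quad_add, abs_le]
    constructor <;> linarith
  refine tendsto_pi_nhds.2 fun a => tendsto_pi_nhds.2 fun b => ?_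
  rw [Metric.tendsto_atTop]
  intro d hd
  have he' : Tendsto (fun n => e n * ((S a a + S b b) / 2)) atTop (𝓝 0) := by
    simpa using he.mul_const ((S a a + S b b) / 2)
  obtain ⟨n, hn⟩ := (he'.eventually_lt_const hd).exists
  exact ⟨n * T, fun t ht => by
    rw [Real.dist_eq]
    simpa using (hb n t ht a b).trans_lt hn⟩

/-- A periodic solution. -/
theorem exists_fixed (h : PeriodicSystem A W R T) (hs : HasSuper A W R T) :
    ∃ Y V, IsFlow A (fun _ => W) R Y V ∧ (Y 0).PosDef ∧ Y T = Y 0 := by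
  obtain ⟨O, V', hO, hO0, hOT⟩ := h.exists_zero_flow
  obtain ⟨Z, U, hZ, hZ0, hZT⟩ := hs
  have hsh := fun n => hZ.shift_periodic h.pos.le h.periodic n
  have hsucc : ∀ n : ℕ, T + n * T = (n + 1 : ℕ) * T := fun n => by push_cast; ring
  have hnn : ∀ n : ℕ, 0 ≤ (n : ℝ) * T := fun n => by have := h.pos; positivity
  have hmono : ∀ (n : ℕ) x, quad (Z ((n + 1 : ℕ) * T)) x ≤ quad (Z (n * T)) x := by
    intro n
    induction n with
    | zero => simpa using hZT
    | succ n ih =>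
      intro x
      have := (hsh n).mono (hsh (n + 1)) h.R_psd (by simpa using ih) h.pos.le x
      simpa only [hsucc] using this
  have hZnn : ∀ (n : ℕ) x, 0 ≤ quad (Z (n * T)) x := fun n =>
    h.flow_nonneg hZ (psd_quad hZ0.posSemidef) (hnn n)
  -- The iterates of the period map from `Z 0` decrease; their limit dominates `O T`, so it is
  -- positive definite.
  obtain ⟨Y₀, hY₀, hlim, hqlim⟩ := exists_limit_of_antitone
    (X := fun n : ℕ => Z (n * T)) (fun n => hZ.symm _ (hnn n)) hmono hZnn
  have hlow : ∀ x, quad (O T) x ≤ quad Y₀ x := fun x => by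
    refine ge_of_tendsto ((hqlim x).comp (tendsto_add_atTop_nat 1)) (.of_forall fun n => ?_)
    have := (hsh n).mono hO h.R_psd (fun x => by simpa [hO0] using hZnn n x) h.pos.le x
    simpa only [hsucc] using! this
  have hpd : Y₀.PosDef := posDef_iff.2 ⟨hY₀, fun x hx => (pd_quad hOT hx).trans_le (hlow x)⟩
  have hle : ∀ (n : ℕ) x, quad Y₀ x ≤ quad (Z (n * T)) x := fun n x =>
    (antitone_nat_of_succ_le fun n => hmono n x).le_of_tendsto (hqlim x) n
  obtain ⟨Y, V, hY, rfl⟩ := h.exists_flow hpd.posSemidef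
  refine ⟨Y, V, hY, hpd, ext_quad (hY.symm T h.pos.le) hY₀ fun x => le_antisymm ?_ ?_⟩
  · refine ge_of_tendsto ((hqlim x).comp (tendsto_add_atTop_nat 1)) (.of_forall fun n => ?_)
    have := (hsh n).mono hY h.R_psd (fun x => by simpa using hle n x) h.pos.le x
    simpa only [hsucc] using! this
  -- Scaling replaces continuity of the period map: once `Z (n T) ≤ (1 + C r) Y 0`, the next iterate
  -- is at most `(1 + C r) Y T`.
  · refine le_of_forall_pos_le_add fun d hd => ?_
    obtain ⟨C, hC, hCb⟩ := exists_abs_quad_le hpd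
    obtain ⟨r, hr, hr0⟩ : ∃ r : ℝ, 0 < r ∧ C * r * quad (Y 0) x ≤ d := by
      have h0 := psd_quad hpd.posSemidef x
      refine ⟨d / (C * (quad (Y 0) x + 1)), by positivity, ?_⟩
      rw [mul_div_assoc', div_mul_eq_mul_div, div_le_iff₀ (by positivity)]
      nlinarith [mul_pos hC hd]
    have hev : ∀ᶠ n : ℕ in atTop, ∀ a b, |(Z (n * T) - Y 0) a b| ≤ r := by
      simp only [eventually_all]
      intro a b
      have h1 := ((hlim a b).sub_const (Y 0 a b)).abs
      rw [sub_self, abs_zero] at h1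
      exact (h1.eventually_lt_const hr).mono fun n hn => by simpa using hn.le
    obtain ⟨n, hn⟩ := hev.exists
    have h1 : ∀ x, quad (Z (n * T)) x ≤ (1 + C * r) * quad (Y 0) x := fun x => by
      have := le_of_abs_le (hCb _ r hr.le hn x)
      rw [quad_sub] at this
      linarith
    have hpos : 0 < 1 + C * r := by positivity
    have h2 := h.scale hY (hsh n) (c := (1 + C * r)⁻¹) (by positivity)
      (inv_le_one_of_one_le₀ (by linarith [mul_pos hC hr]))
      (fun x => by rw [inv_mul_le_iff₀ hpos]; simpa using h1 x) h.pos.le x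
    rw [inv_mul_le_iff₀ hpos, hsucc] at h2
    have h3 : quad (Y T) x ≤ quad (Y 0) x := by
      refine ge_of_tendsto ((hqlim x).comp (tendsto_add_atTop_nat 1)) (.of_forall fun n => ?_)
      have := (hsh n).mono hY h.R_psd (fun x => by simpa using hle n x) h.pos.le x
      simpa only [hsucc] using! this
    have h4 := mul_le_mul_of_nonneg_left h3 (mul_pos hC hr).le
    linarith [hle (n + 1) x]

theorem periodic_of_fixed (h : PeriodicSystem A W R T) (hY : IsFlow A (fun _ => W) R Y V)
    (hfix : Y T = Y 0) (n : ℕ) : ∀ t, 0 ≤ t → Y (t + n * T) = Y t := by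
  induction n with
  | zero => simp
  | succ n ih =>
    intro t ht
    have h1 := (hY.shift_periodic h.pos.le h.periodic 1).unique hY h.R_psd (by simpa using hfix)
      (t := t + n * T) (by have := h.pos; positivity)
    rw [show t + ((n + 1 : ℕ) : ℝ) * T = t + n * T + ((1 : ℕ) : ℝ) * T by push_cast; ring, h1,
      ih t ht]

/-- The periodic limit of all solutions with positive definite initial values. -/
theorem exists_periodic (h : PeriodicSystem A W R T) (hs : HasSuper A W R T) :
    ∃ Y, Function.Periodic Y T ∧ ∀ X U, IsFlow A (fun _ => W) R X U → (X 0).PosDef →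
      Tendsto (fun t => X t - Y t) atTop (𝓝 0) := by
  obtain ⟨Y, V, hY, hpd, hfix⟩ := h.exists_fixed hs
  -- The flow is controlled only for `t ≥ 0`; its first period is repeated over the whole line.
  refine ⟨fun t => Y (T * Int.fract (t / T)), fun t => ?_, fun X U hX hX0 => ?_⟩
  · simp only [add_div, div_self h.pos.ne', Int.fract_add_one]
  · refine (h.tendsto_sub hs hX hX0 hY hpd).congr' ?_
    filter_upwards [eventually_ge_atTop 0] with t ht
    congr 1
    have hf : 0 ≤ T * Int.fract (t / T) := mul_nonneg h.pos.le (Int.fract_nonneg _)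
    rw [← h.periodic_of_fixed hY hfix ⌊t / T⌋₊ _ hf]
    congr 1
    have h1 := Int.self_sub_floor (t / T)
    have h2 : ((⌊t / T⌋₊ : ℕ) : ℝ) = (⌊t / T⌋ : ℝ) := by
      exact_mod_cast natCast_floor_eq_intCast_floor (div_nonneg ht h.pos.le)
    have h3 : T * (t / T) = t := mul_div_cancel₀ t h.pos.ne'
    rw [h2, ← h1]
    linarith

end PeriodicSystem

end Periodic

end Riccati

namespace Riccati

open Matrix Set Filter Topology

/-! ### From the feasible `Q` to a nonincreasing initial value -/

section Supersolution

variable {ι : Type*} [Fintype ι] [DecidableEq ι]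
variable {A W : Matrix ι ι ℝ} {R : ℝ → Matrix ι ι ℝ} {T : ℝ}

/-- On the unobservable directions, the Lyapunov function of a feasible point decreases strictly
over one period. -/
theorem quad_lt_of_unobservable {Q R₀ : Matrix ι ι ℝ} (hW : W.PosSemidef) (hc : Ctrl A W)
    (hQ : Q.PosDef) (hineq : (R₀ - (Q * A + Aᵀ * Q + Q * W * Q)).PosSemidef) (hT : 0 < T)
    {w : ι → ℝ} (hw : w ≠ 0)
    (hobs : ∀ t, 0 ≤ t → t < T → R₀ *ᵥ (NormedSpace.exp (t • A) *ᵥ w) = 0) :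
    quad Q (NormedSpace.exp (T • A) *ᵥ w) < quad Q w := by
  set E : ℝ → Matrix ι ι ℝ := fun t => NormedSpace.exp (t • A) with hEdef
  set P := R₀ - (Q * A + Aᵀ * Q + Q * W * Q) with hP
  have hE : RightDiff E fun t => A * E t := rightDiff_exp A
  have hE0 : E 0 = 1 := by simp [E, NormedSpace.exp_zero]
  -- `R₀` vanishes along this trajectory, so the derivative of minus the `Q`-form is a sum of two
  -- nonnegative terms.
  have hD := ((hE.transpose.mul_const Q).mul hE).smul (-1) |>.congr_deriv
    (Y' := fun t => (E t)ᵀ * (P + Q * W * Q - R₀) * E t) (fun t _ => by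
      simp only [hP, transpose_mul]
      simp only [neg_smul, one_smul]
      noncomm_ring)
  have hval : ∀ t, 0 ≤ t → t < T → quad ((E t)ᵀ * (P + Q * W * Q - R₀) * E t) w =
      quad P (E t *ᵥ w) + quad W (Q *ᵥ (E t *ᵥ w)) := fun t ht htT => by
    rw [quad_conj, quad_sub, quad_add, quad_conj_symm (pd_symm hQ)]
    have : quad R₀ (E t *ᵥ w) = 0 := by simp [quad, hobs t ht htT, hEdef]
    rw [this, sub_zero]
  have hnn : ∀ t, 0 ≤ t → t < T → 0 ≤ quad ((E t)ᵀ * (P + Q * W * Q - R₀) * E t) w :=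
    fun t ht htT => by
      rw [hval t ht htT]; exact add_nonneg (psd_quad hineq _) (psd_quad hW _)
  by_contra! hcon
  have hzero : ∀ t, 0 ≤ t → t < T → P *ᵥ (E t *ᵥ w) = 0 ∧ W *ᵥ (Q *ᵥ (E t *ᵥ w)) = 0 := by
    intro t ht htT
    have h1 := hD.quad_deriv_eq_zero w hnn (by
      rw [quad_smul, quad_smul, quad_conj, quad_conj, hE0, one_mulVec]; linarith) ht htT
    rw [hval t ht htT] at h1
    have h2 := psd_quad hineq (E t *ᵥ w)
    have h3 := psd_quad hW (Q *ᵥ (E t *ᵥ w))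
    exact ⟨psd_mulVec hineq (by linarith), psd_mulVec hW (by linarith)⟩
  -- Without strict decrease both terms vanish; then `Q exp (t A) w` obeys the adjoint equation
  -- inside the kernel of `W`, and controllability forces `Q w = 0`.
  have hy := hc.eq_zero (hE.const_mul Q) (c := w) (T := T) (fun t ht htT => by
    obtain ⟨h1, h2⟩ := hzero t ht htT
    have h3 : R₀ *ᵥ (E t *ᵥ w) = 0 := hobs t ht htT
    simp only [hP, sub_mulVec, add_mulVec, h3, ← mulVec_mulVec, h2, mulVec_zero] at h1 ⊢
    rw [add_zero, zero_sub, neg_eq_zero] at h1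
    exact eq_neg_of_add_eq_zero_left h1) (fun t ht htT => by
    rw [← mulVec_mulVec]; exact (hzero t ht htT).2) le_rfl hT
  rw [hE0, Matrix.mul_one] at hy
  have h1 := pd_quad hQ hw
  simp [quad, hy] at h1

/-- Lyapunov equations are treated as Riccati equations without quadratic term, so the existence and
positivity results for flows apply to them. -/
theorem isFlow_lyapunov {W : ℝ → Matrix ι ι ℝ} {B : Matrix ι ι ℝ} {X U : ℝ → Matrix ι ι ℝ}
    (h : IsFlow B W (fun _ => 0) X U) :
    RightDiff X (fun t => B * X t + X t * Bᵀ + W t) :=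
  h.sol.congr_deriv fun t _ => by simp [ric]

/-- A feasible point of the averaged program bounds the switched equation. -/
theorem PeriodicSystem.hasSuper (h : PeriodicSystem A W R T) {Q R₀ : Matrix ι ι ℝ} (hQ : Q.PosDef)
    (hineq : (R₀ - (Q * A + Aᵀ * Q + Q * W * Q)).PosSemidef)
    (hobs : ∀ w, (∀ t, 0 ≤ t → t < T → R t *ᵥ (NormedSpace.exp (t • A) *ᵥ w) = 0) →
      ∀ t, 0 ≤ t → t < T → R₀ *ᵥ (NormedSpace.exp (t • A) *ᵥ w) = 0) : HasSuper A W R T := by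
  have hz : ∀ t : ℝ, 0 ≤ t → (0 : Matrix ι ι ℝ).PosSemidef := fun _ _ => .zero
  -- Three solutions of the dual Lyapunov equation: `q` transports `Q`, `G` is the observability
  -- Gramian with source `R`, and `C` is the response to the source `1`.
  obtain ⟨q, Uq, hq, hq0⟩ := exists_isFlow (-Aᵀ) (isStep_const ((0 : Matrix ι ι ℝ), (0 : Matrix ι ι ℝ)))
    hz hz hQ.posSemidef
  obtain ⟨G, UG, hG, hG0⟩ := exists_isFlow (-Aᵀ) (h.R_step.map fun r => (r, (0 : Matrix ι ι ℝ)))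
    h.R_psd hz PosSemidef.zero
  obtain ⟨C, UC, hC, hC0⟩ := exists_isFlow (-Aᵀ) (isStep_const ((1 : Matrix ι ι ℝ), (0 : Matrix ι ι ℝ)))
    (fun _ _ => .one) hz PosSemidef.zero
  have dq := isFlow_lyapunov hq
  have dG := isFlow_lyapunov hG
  have dC := isFlow_lyapunov hC
  simp only [transpose_neg, transpose_transpose] at dq dG dC
  set E : ℝ → Matrix ι ι ℝ := fun t => NormedSpace.exp (t • A) with hEdef
  have hE : RightDiff E fun t => A * E t := rightDiff_exp A
  have hE0 : E 0 = 1 := by simp [E, NormedSpace.exp_zero]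
  have eq := ((hE.transpose.mul dq).mul hE).congr_deriv (Y' := fun _ => 0) (fun t _ => by
    simp only [transpose_mul]; noncomm_ring)
  have eG := ((hE.transpose.mul dG).mul hE).congr_deriv (Y' := fun t => (E t)ᵀ * R t * E t)
    (fun t _ => by simp only [transpose_mul]; noncomm_ring)
  have hGnn : ∀ w t, 0 ≤ t → t < T → 0 ≤ quad ((E t)ᵀ * R t * E t) w := fun w t ht _ => by
    rw [quad_conj]; exact psd_quad (h.R_psd t ht) _
  have hpre : ∀ v, ∃ w, E T *ᵥ w = v := fun v => ⟨NormedSpace.exp (-T • A) *ᵥ v, by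
    rw [mulVec_mulVec, exp_smul_mul_neg, one_mulVec]⟩
  have hGT : ∀ v, 0 ≤ quad (G T) v := fun v => by
    obtain ⟨w, rfl⟩ := hpre v
    have h1 := eG.quad_le w h.pos.le (hGnn w)
    simpa [quad_conj, hG0] using h1
  -- On the kernel of `G T` the unobservable case gives `q T > Q`; Finsler's lemma extends this to
  -- all directions by adding `k • G T`.
  obtain ⟨k, hk, c, hc, hkc⟩ := exists_quad_add_mul_ge (M := q T - Q) hGT (fun v hv hv0 => by
    obtain ⟨w, rfl⟩ := hpre v
    have hw : w ≠ 0 := by rintro rfl; simp at hv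
    have h1 : ∀ t, 0 ≤ t → t < T → R t *ᵥ (E t *ᵥ w) = 0 := fun t ht htT => by
      refine psd_mulVec (h.R_psd t ht) ?_
      rw [← quad_conj]
      exact eG.quad_deriv_eq_zero w (hGnn w) (by rw [quad_conj, quad_conj, hv0, hG0]; simp) ht htT
    have h2 := quad_lt_of_unobservable h.W_psd h.ctrl hQ hineq h.pos hw (hobs w h1)
    have h3 := congrArg (quad · w) (eq.const_of_deriv_zero h.pos.le)
    simp only [quad_conj, hE0, one_mulVec, hq0] at h3
    rw [quad_sub, h3]
    exact sub_pos.2 h2)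
  have hN : (q T - Q + k • G T).PosDef := posDef_iff.2 ⟨by
    rw [transpose_add, transpose_sub, transpose_smul, hq.symm T h.pos.le, hG.symm T h.pos.le,
      pd_symm hQ], fun x hx => by
    have := hkc x
    have h1 : 0 < ‖x‖ := norm_pos_iff.2 hx
    rw [quad_add, quad_smul]
    exact lt_of_lt_of_le (by positivity) this⟩
  obtain ⟨τ, hτ, -, hτC⟩ := exists_smul_quad_le (M := C T) hN
  -- `τ` is small enough that `s T ≥ Q = s 0` still holds; the source `-τ • 1` leaves room for the
  -- quadratic term.
  let s : ℝ → Matrix ι ι ℝ := fun t => q t + k • G t - τ • C t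
  have ds := (dq.add (dG.smul k)).sub (dC.smul τ) |>.congr_deriv
    (Y' := fun t => -Aᵀ * s t + s t * -A + (k • R t - τ • (1 : Matrix ι ι ℝ))) (fun t _ => by
      simp only [s, Matrix.mul_add, Matrix.add_mul, Matrix.mul_sub, Matrix.sub_mul,
        Matrix.smul_mul, Matrix.mul_smul]
      module)
  have hs : ∀ t, 0 ≤ t → (s t)ᵀ = s t := fun t ht => by
    simp only [s, transpose_sub, transpose_add, transpose_smul, hq.symm t ht, hG.symm t ht,
      hC.symm t ht]
  have hs0 : s 0 = Q := by simp [s, hq0, hG0, hC0]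
  obtain ⟨K, hK, hKb⟩ := exists_abs_quad_le (S := (1 : Matrix ι ι ℝ)) PosDef.one
  obtain ⟨r, hr, hrb⟩ := exists_entry_bound (T := T) ((ds.mul_const W).mul ds).cont
  -- The first bound makes `(1 - δ k) R` nonnegative, the second makes `δ τ` dominate `δ ^ 2 s W s`.
  -- Hence `δ • s` is a subsolution of the dual equation.
  let δ := min (1 / (k + 1)) (τ / (K * r + 1))
  have hδ : 0 < δ := lt_min (by positivity) (by positivity)
  have hδk : δ * k ≤ 1 := by
    have h1 : δ * (k + 1) ≤ 1 := by
      rw [← le_div_iff₀ (by positivity)]; exact min_le_left _ _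
    linarith
  have hδr : δ * (K * r) ≤ τ := by
    have h1 : δ * (K * r + 1) ≤ τ := by
      rw [← le_div_iff₀ (by positivity)]; exact min_le_right _ _
    linarith
  have hδQ : (δ • Q).PosDef := hQ.smul hδ
  obtain ⟨X, U, S, V, hX, hS, hX0, hS0, hXS⟩ := exists_isFlow_pair A
    (h.R_step.map fun r => (W, r)) (fun _ _ => h.W_psd) h.R_psd hδQ.inv
  rw [nonsing_inv_nonsing_inv _ ((isUnit_iff_isUnit_det _).1 hδQ.isUnit)] at hS0
  -- It remains that the dual solution from `δ Q` does not decrease over the period; inversion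
  -- reverses the order.
  refine ⟨X, U, hX, (hXS 0 le_rfl).1, quad_inv_le (hS0 ▸ hδQ) (hXS T h.pos.le).2
    (hXS 0 le_rfl).2 fun x => ?_⟩
  have h1 := hS.ge_of_subsolution (fun _ _ => h.W_psd) (ds.smul δ)
    (fun t ht => by rw [transpose_smul, show (q t + k • G t - τ • C t)ᵀ = _ from hs t ht])
    (fun x => by rw [hS0, show q 0 + k • G 0 - τ • C 0 = Q from hs0]) h.pos.le
    (fun t ht htT x => by
      have h1 : ric (-Aᵀ) (R t) W (δ • s t) =
          δ • (-Aᵀ * s t + s t * -A + (k • R t - τ • (1 : Matrix ι ι ℝ))) +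
          ((1 - δ * k) • R t + (δ * τ) • 1 - (δ * δ) • (s t * W * s t)) := by
        simp only [ric, transpose_neg, transpose_transpose, Matrix.smul_mul, Matrix.mul_smul]
        module
      change _ ≤ quad (ric (-Aᵀ) (R t) W (δ • s t)) x
      rw [h1, quad_add (δ • _) _]
      refine le_add_of_nonneg_right ?_
      rw [quad_sub, quad_add, quad_smul, quad_smul, quad_smul]
      have h2 := le_of_abs_le (hKb _ r hr (hrb t ht htT.le) x)
      change quad (s t * W * s t) x ≤ _ at h2
      have h3 := mul_nonneg (sub_nonneg.2 hδk) (psd_quad (h.R_psd t ht) x)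
      have h4 := psd_quad (PosDef.one (n := ι) (R := ℝ)).posSemidef x
      have h5 := mul_le_mul_of_nonneg_left h2 (mul_pos hδ hδ).le
      have h6 := mul_le_mul_of_nonneg_right (mul_le_mul_of_nonneg_left hδr hδ.le) h4
      linarith) x
  refine le_trans ?_ h1
  rw [hS0, quad_smul, quad_smul]
  refine mul_le_mul_of_nonneg_left ?_ hδ.le
  have h2 := hτC x
  simp only [quad_add, quad_sub, quad_smul] at h2 ⊢
  linarith

end Supersolution

end Riccati

namespace Riccati

open Matrix Set Filter Topology

/-! ### The averaged algebraic Riccati equation -/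

section Equilibrium

variable {ι : Type*} [Fintype ι] [DecidableEq ι]
variable {A W R₀ : Matrix ι ι ℝ}

theorem periodicSystem_const (hW : W.PosSemidef) (hc : Ctrl A W) (hR : R₀.PosSemidef) :
    PeriodicSystem A W (fun _ => R₀) 1 :=
  ⟨hW, hc, fun _ _ => hR, isStep_const R₀, one_pos, fun _ => rfl⟩

/-- The algebraic Riccati equation has a positive definite solution. -/
theorem exists_equilibrium {Q : Matrix ι ι ℝ} (hW : W.PosSemidef) (hc : Ctrl A W)
    (hR : R₀.PosSemidef) (hQ : Q.PosDef)
    (hineq : (R₀ - (Q * A + Aᵀ * Q + Q * W * Q)).PosSemidef) :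
    HasSuper A W (fun _ => R₀) 1 ∧ ∃ X : Matrix ι ι ℝ, X.PosDef ∧ ric A W R₀ X = 0 := by
  have h := periodicSystem_const hW hc hR
  have hs := h.hasSuper hQ hineq fun w hw => hw
  obtain ⟨Y, V, hY, hpd, hfix⟩ := h.exists_fixed hs
  refine ⟨hs, Y 0, hpd, ?_⟩
  -- With constant coefficients every time shift of `Y` is again a solution. The difference is
  -- periodic and tends to zero, so it vanishes; the period `1` is arbitrary.
  have hconst : ∀ s, 0 ≤ s → Y s = Y 0 := by
    intro s hs0
    rcases hs0.eq_or_lt with rfl | hs1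
    · rfl
    have h1 := h.tendsto_sub hs (hY.shift hs0)
      (by simpa using hY.posDef hW (fun _ _ => hR) hc (psd_quad hpd.posSemidef) hs1) hY hpd
    have h2 := h1.comp (tendsto_natCast_atTop_atTop (R := ℝ))
    have h3 : (fun t => Y (t + s) - Y t) ∘ (Nat.cast : ℕ → ℝ) = fun _ => Y s - Y 0 := by
      funext n
      have e1 := h.periodic_of_fixed hY hfix n s hs0
      have e2 := h.periodic_of_fixed hY hfix n 0 le_rfl
      simp only [mul_one, zero_add] at e1 e2
      simp only [Function.comp_apply, add_comm (n : ℝ) s, e1, e2]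
    rw [h3] at h2
    exact sub_eq_zero.1 (tendsto_nhds_unique tendsto_const_nhds h2)
  have hd := hY.sol.sub (RightDiff.const (Y 0))
  ext a b
  have h1 := hd.mulVec_deriv_eq_zero (c := Pi.single b 1) (T := 1)
    (fun t ht _ => by rw [hconst t ht, sub_self, zero_mulVec]) le_rfl one_pos
  simpa using congrFun h1 a

theorem equilibrium_unique (hW : W.PosSemidef) (hc : Ctrl A W) (hR : R₀.PosSemidef)
    (hs : HasSuper A W (fun _ => R₀) 1) {X Y : Matrix ι ι ℝ} (hX : X.PosDef) (hY : Y.PosDef)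
    (hX0 : ric A W R₀ X = 0) (hY0 : ric A W R₀ Y = 0) : X = Y := by
  have h := periodicSystem_const hW hc hR
  obtain ⟨X', U, hX', rfl⟩ := h.exists_flow hX.posSemidef
  obtain ⟨Y', V, hY', rfl⟩ := h.exists_flow hY.posSemidef
  have h1 := h.tendsto_sub hs hX' hX hY' hY
  have e1 : ∀ t, 0 ≤ t → X' 0 = X' t := fun t ht =>
    hX'.eq_of_sol h.R_step ((RightDiff.const (X' 0)).congr_deriv fun _ _ => hX0.symm) rfl ht
  have e2 : ∀ t, 0 ≤ t → Y' 0 = Y' t := fun t ht =>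
    hY'.eq_of_sol h.R_step ((RightDiff.const (Y' 0)).congr_deriv fun _ _ => hY0.symm) rfl ht
  have h2 : Tendsto (fun t => X' t - Y' t) atTop (𝓝 (X' 0 - Y' 0)) := by
    refine tendsto_const_nhds.congr' ?_
    filter_upwards [eventually_ge_atTop 0] with t ht
    rw [← e1 t ht, ← e2 t ht]
  exact sub_eq_zero.1 (tendsto_nhds_unique h2 h1)

/-- Lyapunov's argument on the real and imaginary parts `a`, `b` of a left eigenvector, using `F X +
X Fᵀ = -(W + X R₀ X)`. If the real part of `z` were nonnegative, `W` and `R₀ X` would kill `a` and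
`b`; their span would then be `Aᵀ`-invariant inside the kernel of `W`, against controllability. -/
theorem equilibrium_hurwitz (hW : W.PosSemidef) (hc : Ctrl A W) (hR : R₀.PosSemidef)
    {X : Matrix ι ι ℝ} (hX : X.PosDef) (hX0 : ric A W R₀ X = 0) {z : ℂ}
    (hz : z ∈ spectrum ℂ ((A - X * R₀).map (algebraMap ℝ ℂ))) : z.re < 0 := by
  set F := A - X * R₀ with hF
  rw [spectrum.mem_iff, isUnit_iff_isUnit_det, isUnit_iff_ne_zero, not_not] at hz
  obtain ⟨v, hv, hvz⟩ := exists_vecMul_eq_zero_iff.2 hz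
  rw [vecMul_sub, sub_eq_zero] at hvz
  let a : ι → ℝ := fun i => (v i).re
  let b : ι → ℝ := fun i => (v i).im
  have hvz' : ∀ i, z * v i = ∑ j, v j * (F j i : ℂ) := fun i => by
    have := congrFun hvz i
    simpa [vecMul, dotProduct, algebraMap_eq_diagonal, diagonal_apply, mul_comm] using this
  have ha : Fᵀ *ᵥ a = z.re • a - z.im • b := by
    ext i
    have := congrArg Complex.re (hvz' i)
    simp only [Complex.mul_re, Complex.re_sum, Complex.ofReal_re, Complex.ofReal_im, mul_zero,
      sub_zero] at this
    simp [mulVec, dotProduct, a, b, this, mul_comm]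
  have hb : Fᵀ *ᵥ b = z.im • a + z.re • b := by
    ext i
    have := congrArg Complex.im (hvz' i)
    simp only [Complex.mul_im, Complex.im_sum, Complex.ofReal_re, Complex.ofReal_im, mul_zero,
      zero_add] at this
    simp only [mulVec, dotProduct, transpose_apply, Pi.add_apply, Pi.smul_apply, smul_eq_mul, a, b]
    rw [add_comm, this]
    exact Finset.sum_congr rfl fun _ _ => mul_comm _ _
  have hXs := pd_symm hX
  have key : F * X + X * Fᵀ = -(W + X * R₀ * X) := by
    have h1 : F * X + X * Fᵀ = ric A W R₀ X - (W + X * R₀ * X) := by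
      simp only [hF, ric, transpose_sub, transpose_mul, hXs, psd_symm hR]
      noncomm_ring
    rw [h1, hX0, zero_sub]
  have hq : ∀ c, 2 * ((Fᵀ *ᵥ c) ⬝ᵥ (X *ᵥ c)) = -(quad W c + quad R₀ (X *ᵥ c)) := fun c => by
    have h1 := congrArg (quad · c) key
    simp only [quad_add, quad_neg, quad_conj_symm hXs] at h1
    rw [quad_mul, quad_mul, hXs, dotProduct_comm (X *ᵥ c)] at h1
    linarith
  have hqa := hq a
  have hqb := hq b
  rw [ha, sub_dotProduct, smul_dotProduct, smul_dotProduct] at hqa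
  rw [hb, add_dotProduct, smul_dotProduct, smul_dotProduct, symm_dot a b hXs] at hqb
  simp only [smul_eq_mul] at hqa hqb
  change 2 * (z.re * quad X a - _) = _ at hqa
  change 2 * (_ + z.re * quad X b) = _ at hqb
  have hsum : 2 * z.re * (quad X a + quad X b) =
      -(quad W a + quad R₀ (X *ᵥ a) + (quad W b + quad R₀ (X *ᵥ b))) := by linarith
  have hab : 0 < quad X a + quad X b := by
    by_cases ha0 : a = 0
    · have hb0 : b ≠ 0 := by
        intro hb0
        refine hv (funext fun i => Complex.ext ?_ ?_)
        · exact congrFun ha0 i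
        · exact congrFun hb0 i
      linarith [pd_quad hX hb0, psd_quad hX.posSemidef a]
    · linarith [pd_quad hX ha0, psd_quad hX.posSemidef b]
  by_contra! hre
  have n1 := psd_quad hW a
  have n2 := psd_quad hW b
  have n3 := psd_quad hR (X *ᵥ a)
  have n4 := psd_quad hR (X *ᵥ b)
  have n5 : 0 ≤ 2 * z.re * (quad X a + quad X b) := by positivity
  have Wa := psd_mulVec hW (x := a) (by linarith)
  have Wb := psd_mulVec hW (x := b) (by linarith)
  have Ra := psd_mulVec hR (x := X *ᵥ a) (by linarith)
  have Rb := psd_mulVec hR (x := X *ᵥ b) (by linarith)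
  have hFA : ∀ c, R₀ *ᵥ (X *ᵥ c) = 0 → Fᵀ *ᵥ c = Aᵀ *ᵥ c := fun c h => by
    rw [hF, transpose_sub, transpose_mul, psd_symm hR, hXs, sub_mulVec, ← mulVec_mulVec, h,
      sub_zero]
  rw [hFA a Ra] at ha
  rw [hFA b Rb] at hb
  have hpow : ∀ j : ℕ, W *ᵥ (Aᵀ ^ j *ᵥ a) = 0 ∧ W *ᵥ (Aᵀ ^ j *ᵥ b) = 0 := by
    intro j
    induction j with
    | zero => simpa using ⟨Wa, Wb⟩
    | succ j ih =>
      rw [pow_succ, ← mulVec_mulVec, ← mulVec_mulVec, ha, hb]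
      simp only [mulVec_sub, mulVec_add, mulVec_smul, ih.1, ih.2]
      simp
  have ha0 := hc a fun j => (hpow j).1
  have hb0 := hc b fun j => (hpow j).2
  simp [ha0, hb0] at hab

/-- A strict Lyapunov matrix for the closed loop of the dual equation at an equilibrium. -/
theorem exists_strict_lyapunov (hW : W.PosSemidef) (hc : Ctrl A W) (hR : R₀.PosSemidef)
    {S : Matrix ι ι ℝ} (hS : S.PosDef) (hS0 : ric (-Aᵀ) R₀ W S = 0) :
    ∃ L : Matrix ι ι ℝ, Lᵀ = L ∧ ((A + W * S)ᵀ * L + L * (A + W * S)).PosDef := by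
  set F := A + W * S with hF
  have hz : ∀ t : ℝ, 0 ≤ t → (0 : Matrix ι ι ℝ).PosSemidef := fun _ _ => .zero
  -- `S` itself is only a weak Lyapunov matrix: `Fᵀ S + S F = R₀ + S W S` may be singular. Averaging
  -- `S` along the flow of `-F` over unit time replaces this source by its Gramian, which
  -- controllability makes definite.
  obtain ⟨C, U, hC, hC0⟩ := exists_isFlow (-Fᵀ) (isStep_const (S, (0 : Matrix ι ι ℝ)))
    (fun _ _ => hS.posSemidef) hz PosSemidef.zero
  have dC := isFlow_lyapunov hC
  simp only [transpose_neg, transpose_transpose] at dC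
  have hSs := pd_symm hS
  have key : Fᵀ * S + S * F = R₀ + S * W * S := by
    have h1 : Fᵀ * S + S * F = R₀ + S * W * S - ric (-Aᵀ) R₀ W S := by
      simp only [hF, ric, transpose_add, transpose_mul, transpose_neg, transpose_transpose, hSs,
        psd_symm hW]
      noncomm_ring
    rw [h1, hS0, sub_zero]
  have dD := ((dC.const_mul Fᵀ).add (dC.mul_const F)).congr_deriv
    (Y' := fun t => ric (-Fᵀ) (R₀ + S * W * S) 0 (Fᵀ * C t + C t * F)) (fun t _ => by
      simp only [ric, ← key, transpose_neg, transpose_transpose]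
      noncomm_ring)
  have hD : IsFlow (-Fᵀ) (fun _ => R₀ + S * W * S) (fun _ => 0)
      (fun t => Fᵀ * C t + C t * F) (fun t => NormedSpace.exp (t • F)) := by
    refine ⟨dD, (rightDiff_exp F).congr_deriv fun t _ => by simp, fun t _ => Matrix.isUnit_exp _,
      fun t ht => ?_⟩
    rw [transpose_add, transpose_mul, transpose_mul, hC.symm t ht, transpose_transpose, add_comm]
  have hK : (R₀ + S * W * S).PosSemidef := posSemidef_iff.2 ⟨by
    simp only [transpose_add, transpose_mul, hSs, psd_symm hW, psd_symm hR, Matrix.mul_assoc],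
    fun x => by
      rw [quad_add, quad_conj_symm hSs]
      exact add_nonneg (psd_quad hR _) (psd_quad hW _)⟩
  refine ⟨C 1, hC.symm 1 zero_le_one, ?_⟩
  refine hD.posDef_of_observable (fun _ _ => hK) hz (fun x => by simp [hC0]) zero_le_one
    fun c hobs => ?_
  have h1 : ∀ t : ℝ, 0 ≤ t → t < 1 → R₀ *ᵥ (NormedSpace.exp (t • F) *ᵥ c) = 0 ∧
      W *ᵥ (S *ᵥ (NormedSpace.exp (t • F) *ᵥ c)) = 0 := fun t ht htT => by
    have h2 := (hobs t ht htT).1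
    have h3 : quad (R₀ + S * W * S) (NormedSpace.exp (t • F) *ᵥ c) = 0 := by
      rw [quad, h2, dotProduct_zero]
    rw [quad_add, quad_conj_symm hSs] at h3
    have h4 := psd_quad hR (NormedSpace.exp (t • F) *ᵥ c)
    have h5 := psd_quad hW (S *ᵥ (NormedSpace.exp (t • F) *ᵥ c))
    exact ⟨psd_mulVec hR (by linarith), psd_mulVec hW (by linarith)⟩
  have hy := hc.eq_zero ((rightDiff_exp F).const_mul S) (c := c) (T := 1) (fun t ht htT => by
    obtain ⟨h2, h3⟩ := h1 t ht htT
    have h4 : Aᵀ * S + S * A + S * W * S = R₀ := by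
      rw [← sub_eq_zero, ← neg_eq_zero, ← hS0, ric, transpose_neg, transpose_transpose]
      noncomm_ring
    have h5 := congrArg (· *ᵥ (NormedSpace.exp (t • F) *ᵥ c)) h4
    simp only [add_mulVec, ← mulVec_mulVec, h2, h3, mulVec_zero, add_zero] at h5
    have h6 : ∀ y, F *ᵥ y = A *ᵥ y + W *ᵥ (S *ᵥ y) := fun y => by
      rw [hF, add_mulVec, mulVec_mulVec]
    rw [← mulVec_mulVec, ← mulVec_mulVec, ← mulVec_mulVec, h6, h3, add_zero]
    exact eq_neg_of_add_eq_zero_right h5) (fun t ht htT => by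
    rw [← mulVec_mulVec]; exact (h1 t ht htT).2) le_rfl one_pos
  simp only [zero_smul, NormedSpace.exp_zero, Matrix.mul_one] at hy
  by_contra hne
  have := pd_quad hS hne
  simp [quad, hy] at this

end Equilibrium

end Riccati

namespace Riccati

open Matrix Set Filter Topology

/-! ### The averaging estimate -/

section Averaging

variable {ι : Type*} [Fintype ι] [DecidableEq ι]
variable {A W R₀ : Matrix ι ι ℝ} {X Y : ℝ → Matrix ι ι ℝ}

theorem continuous_quad_left (x : ι → ℝ) : Continuous fun M : Matrix ι ι ℝ => quad M x :=
  continuous_const.dotProduct (continuous_id.matrix_mulVec continuous_const)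

theorem tendsto_of_periodic {T : ℝ} (hT : 0 < T) (hY : Function.Periodic Y T)
    (h : Tendsto (fun t => X t - Y t) atTop (𝓝 0)) (t : ℝ) :
    Tendsto (fun n : ℕ => X (t + n * T)) atTop (𝓝 (Y t)) := by
  have h1 : Tendsto (fun n : ℕ => t + n * T) atTop atTop :=
    tendsto_atTop_add_const_left _ _ (tendsto_natCast_atTop_atTop.atTop_mul_const hT)
  have h2 := (h.comp h1).add_const (Y t)
  rw [zero_add] at h2
  refine h2.congr fun n => ?_
  have : Y (t + n * T) = Y t := hY.nat_mul n t
  simp [this]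

theorem exists_entry_le (M : Matrix ι ι ℝ) : ∃ r, 0 ≤ r ∧ ∀ a b, |M a b| ≤ r := by
  obtain ⟨r, hr, h⟩ := exists_entry_bound (T := 0) (X := fun _ => M) continuousOn_const
  exact ⟨r, hr, h 0 le_rfl le_rfl⟩

theorem abs_mul_entry_le {M N : Matrix ι ι ℝ} {r s : ℝ} (hr : 0 ≤ r) (hM : ∀ a b, |M a b| ≤ r)
    (hN : ∀ a b, |N a b| ≤ s) (a b : ι) : |(M * N) a b| ≤ Fintype.card ι * (r * s) := by
  rw [mul_apply]
  refine (Finset.abs_sum_le_sum_abs _ _).trans ?_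
  calc _ ≤ ∑ _c : ι, r * s := Finset.sum_le_sum fun c _ => by
        rw [abs_mul]; exact mul_le_mul (hM a c) (hN c b) (abs_nonneg _) hr
    _ = _ := by simp

/-- The derivative of an inverse transforms by the same congruence, so inversion exchanges
subsolutions of one equation with supersolutions of the other. -/
theorem ric_dual_inv {A W R X S : Matrix ι ι ℝ} (h : X * S = 1) :
    ric A W R X = -(X * ric (-Aᵀ) R W S * X) := by
  have h' : S * X = 1 := mul_eq_one_comm.1 h
  have e1 : X * (-Aᵀ * S) * X = -(X * Aᵀ) := by
    rw [Matrix.mul_assoc, Matrix.mul_assoc, h', Matrix.mul_one, Matrix.mul_neg]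
  have e2 : X * (S * (-Aᵀ)ᵀ) * X = -(A * X) := by
    rw [← Matrix.mul_assoc, h, Matrix.one_mul]; simp
  have e3 : X * (S * W * S) * X = W := by
    rw [show X * (S * W * S) * X = X * S * W * (S * X) by noncomm_ring, h, h']; simp
  simp only [ric, Matrix.mul_add, Matrix.mul_sub, Matrix.add_mul, Matrix.sub_mul, e1, e2, e3]
  abel

/-- Expansion around the equilibrium of the averaged dual equation; the linear part is governed by
`A + W * S`. -/
theorem ric_dual_perturb {A W R R₀ S D : Matrix ι ι ℝ} (hW : Wᵀ = W) (hS : Sᵀ = S)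
    (h : ric (-Aᵀ) R₀ W S = 0) :
    ric (-Aᵀ) R W (S + D) = R - R₀ - ((A + W * S)ᵀ * D + D * (A + W * S)) - D * W * D := by
  have : ric (-Aᵀ) R W (S + D) =
      ric (-Aᵀ) R₀ W S + (R - R₀ - ((A + W * S)ᵀ * D + D * (A + W * S)) - D * W * D) := by
    simp only [ric, transpose_add, transpose_mul, transpose_neg, transpose_transpose, hW, hS]
    noncomm_ring
  rw [this, h, zero_add]

/-- The averaging estimate: a sandwich of the periodic limit between multiples of the
equilibrium of the averaged equation. -/
theorem periodic_limit_sandwich {R : ℝ → Matrix ι ι ℝ} {T η κ : ℝ} {L S Xs : Matrix ι ι ℝ}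
    {p : ℝ → Matrix ι ι ℝ} (h : PeriodicSystem A W R T) (hS : S.PosDef)
    (hXS : Xs * S = 1) (hS0 : ric (-Aᵀ) R₀ W S = 0) (hL : Lᵀ = L)
    (hp : RightDiff p fun t => R t - R₀) (hps : ∀ t, 0 ≤ t → (p t)ᵀ = p t)
    (hlow : ∀ t, 0 ≤ t → ∀ x, 0 ≤ quad (κ • ((A + W * S)ᵀ * L + L * (A + W * S)) -
      ((A + W * S)ᵀ * p t + p t * (A + W * S)) - (p t - κ • L) * W * (p t - κ • L)) x)
    (hupp : ∀ t, 0 ≤ t → ∀ x, 0 ≤ quad (κ • ((A + W * S)ᵀ * L + L * (A + W * S)) +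
      ((A + W * S)ᵀ * p t + p t * (A + W * S)) + (p t + κ • L) * W * (p t + κ • L)) x)
    (hη : 0 ≤ η) (hη1 : η ≤ 1 / 2)
    (hm : ∀ t, 0 ≤ t → ∀ x, |quad (p t - κ • L) x| ≤ η * quad S x)
    (hq : ∀ t, 0 ≤ t → ∀ x, |quad (p t + κ • L) x| ≤ η * quad S x)
    (hY : Function.Periodic Y T)
    (hYX : ∀ X U, IsFlow A (fun _ => W) R X U → (X 0).PosDef →
      Tendsto (fun t => X t - Y t) atTop (𝓝 0)) {t : ℝ} (ht : 0 ≤ t) :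
    (Y t)ᵀ = Y t ∧ ∀ x, |quad (Y t - Xs) x| ≤ 2 * η * quad Xs x := by
  have hWs := psd_symm h.W_psd
  have hSs := pd_symm hS
  have hnT : ∀ n : ℕ, 0 ≤ t + n * T := fun n => by have := h.pos; positivity
  have hpd : ∀ D : Matrix ι ι ℝ, Dᵀ = D → (∀ x, |quad D x| ≤ η * quad S x) → (S + D).PosDef :=
    fun D hDs hD => posDef_iff.2 ⟨by rw [transpose_add, hSs, hDs], fun x hx => by
      have h1 := pd_quad hS hx
      have h2 := neg_le_of_abs_le (hD x)
      rw [quad_add]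
      nlinarith⟩
  have sm : ∀ t, 0 ≤ t → (p t - κ • L)ᵀ = p t - κ • L := fun t ht => by
    rw [transpose_sub, transpose_smul, hps t ht, hL]
  have sp : ∀ t, 0 ≤ t → (p t + κ • L)ᵀ = p t + κ • L := fun t ht => by
    rw [transpose_add, transpose_smul, hps t ht, hL]
  have pm := fun t ht => hpd _ (sm t ht) (hm t ht)
  have pp := fun t ht => hpd _ (sp t ht) (hq t ht)
  have dm : RightDiff (fun t => S + (p t - κ • L)) fun t => R t - R₀ :=
    ((RightDiff.const S).add (hp.sub (.const (κ • L)))).congr_deriv fun t _ => by simp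
  have dp : RightDiff (fun t => S + (p t + κ • L)) fun t => R t - R₀ :=
    ((RightDiff.const S).add (hp.add (.const (κ • L)))).congr_deriv fun t _ => by simp
  have hmul : ∀ c : ℝ, c ≠ 0 → (c⁻¹ • Xs) * (c • S) = 1 := fun c hc => by
    rw [Matrix.smul_mul, Matrix.mul_smul, smul_smul, inv_mul_cancel₀ hc, one_smul, hXS]
  have hXs : ∀ x, 0 ≤ quad Xs x := by
    have : Xs = S⁻¹ := (inv_eq_left_inv hXS).symm
    rw [this]
    exact psd_quad hS.inv.posSemidef
  -- the upper bound
  obtain ⟨X₁, U₁, S₁, V₁, hX₁, hS₁, hX₁0, hS₁0, hXS₁⟩ := exists_isFlow_pair A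
    (h.R_step.map fun r => (W, r)) (fun _ _ => h.W_psd) h.R_psd (pm 0 le_rfl).inv
  rw [nonsing_inv_nonsing_inv _ ((isUnit_iff_isUnit_det _).1 (pm 0 le_rfl).isUnit)] at hS₁0
  have b₁ : ∀ s, 0 ≤ s → ∀ x, quad (X₁ s) x ≤ (1 - η)⁻¹ * quad Xs x := by
    intro s hs x
    rw [← quad_smul]
    refine quad_inv_le (hS.smul (by linarith)) (hXS₁ s hs).2 (hmul (1 - η) (by linarith))
      (fun x => ?_) x
    -- The derivative of `S + p - κ L` is `R - R₀`; by `hlow` the remaining terms of the dual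
    -- operator are nonnegative.
    have h1 := hS₁.ge_of_subsolution (fun _ _ => h.W_psd) dm
      (fun t ht => by rw [transpose_add, hSs, sm t ht]) (fun x => by rw [hS₁0]) hs
      (fun t ht _ x => by
        rw [ric_dual_perturb hWs hSs hS0]
        have h1 := hlow t ht x
        have h2 : R t - R₀ - ((A + W * S)ᵀ * (p t - κ • L) + (p t - κ • L) * (A + W * S)) -
            (p t - κ • L) * W * (p t - κ • L) = (R t - R₀) +
            (κ • ((A + W * S)ᵀ * L + L * (A + W * S)) -
            ((A + W * S)ᵀ * p t + p t * (A + W * S)) - (p t - κ • L) * W * (p t - κ • L)) := by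
          generalize (p t - κ • L) * W * (p t - κ • L) = K
          simp only [Matrix.mul_sub, Matrix.sub_mul, Matrix.smul_mul, Matrix.mul_smul]
          module
        rw [h2, quad_add]
        linarith) x
    refine le_trans ?_ h1
    rw [quad_add, quad_smul]
    linarith [neg_le_of_abs_le (hm s hs x)]
  -- the lower bound
  have hinv : ∀ t, 0 ≤ t → (S + (p t + κ • L))⁻¹ * (S + (p t + κ • L)) = 1 := fun t ht =>
    nonsing_inv_mul _ ((isUnit_iff_isUnit_det _).1 (pp t ht).isUnit)
  obtain ⟨X₂, U₂, hX₂, hX₂0⟩ := h.exists_flow (pp 0 le_rfl).inv.posSemidef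
  have b₂ : ∀ s, 0 ≤ s → ∀ x, (1 + η)⁻¹ * quad Xs x ≤ quad (X₂ s) x := by
    intro s hs x
    -- `S + p + κ L` is a supersolution of the dual equation, so its inverse is a subsolution of the
    -- original one and the same comparison applies.
    have h1 := hX₂.ge_of_subsolution h.R_psd (dp.inv fun t ht => (pp t ht).isUnit)
      (fun t ht => pd_symm (pp t ht).inv) (fun x => by rw [hX₂0]) hs
      (fun t ht _ x => by
        rw [ric_dual_inv (hinv t ht), quad_neg, quad_neg,
          quad_conj_symm (pd_symm (pp t ht).inv), quad_conj_symm (pd_symm (pp t ht).inv),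
          ric_dual_perturb hWs hSs hS0]
        have h1 := hupp t ht ((S + (p t + κ • L))⁻¹ *ᵥ x)
        have h2 : R t - R₀ - ((A + W * S)ᵀ * (p t + κ • L) + (p t + κ • L) * (A + W * S)) -
            (p t + κ • L) * W * (p t + κ • L) = (R t - R₀) -
            (κ • ((A + W * S)ᵀ * L + L * (A + W * S)) +
            ((A + W * S)ᵀ * p t + p t * (A + W * S)) + (p t + κ • L) * W * (p t + κ • L)) := by
          generalize (p t + κ • L) * W * (p t + κ • L) = K
          simp only [Matrix.mul_add, Matrix.add_mul, Matrix.smul_mul, Matrix.mul_smul]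
          module
        rw [h2, quad_sub (R t - R₀)]
        linarith) x
    refine le_trans ?_ h1
    rw [← quad_smul]
    refine quad_inv_le (pp s hs) (hmul (1 + η) (by linarith)) (hinv s hs) (fun x => ?_) x
    rw [quad_add, quad_smul]
    linarith [le_of_abs_le (hq s hs x)]
  have l₁ := tendsto_of_periodic h.pos hY (hYX X₁ U₁ hX₁ (hX₁0 ▸ (pm 0 le_rfl).inv)) t
  have l₂ := tendsto_of_periodic h.pos hY (hYX X₂ U₂ hX₂ (hX₂0 ▸ (pp 0 le_rfl).inv)) t
  refine ⟨?_, fun x => ?_⟩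
  · refine tendsto_nhds_unique ((continuous_id.matrix_transpose.tendsto _).comp l₁)
      (l₁.congr fun n => ?_)
    exact (hX₁.symm _ (hnT n)).symm
  · have c₁ : quad (Y t) x ≤ (1 - η)⁻¹ * quad Xs x :=
      le_of_tendsto (((continuous_quad_left x).tendsto _).comp l₁)
        (.of_forall fun n => b₁ _ (hnT n) x)
    have c₂ : (1 + η)⁻¹ * quad Xs x ≤ quad (Y t) x :=
      ge_of_tendsto (((continuous_quad_left x).tendsto _).comp l₂)
        (.of_forall fun n => b₂ _ (hnT n) x)
    have i₁ : (1 - η)⁻¹ ≤ 1 + 2 * η := by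
      rw [inv_le_iff_one_le_mul₀ (by linarith)]; nlinarith
    have i₂ : 1 - 2 * η ≤ (1 + η)⁻¹ := by
      rw [← one_div, le_div_iff₀ (by linarith)]; nlinarith
    have j₁ := mul_le_mul_of_nonneg_right i₁ (hXs x)
    have j₂ := mul_le_mul_of_nonneg_right i₂ (hXs x)
    rw [quad_sub, abs_le]
    constructor <;> linarith

/-- The periodic limit is within `O(T)` of the equilibrium of the averaged equation. -/
theorem exists_averaging_bound (hW : W.PosSemidef) (hc : Ctrl A W) (hR : R₀.PosSemidef)
    {Xs : Matrix ι ι ℝ} (hX : Xs.PosDef) (hX0 : ric A W R₀ Xs = 0) {B : ℝ} (hB : 0 ≤ B) :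
    ∃ K > 0, ∃ T₀ > 0, ∀ T, T ≤ T₀ → ∀ R, PeriodicSystem A W R T →
      ∀ p, RightDiff p (fun t => R t - R₀) → (∀ t, 0 ≤ t → (p t)ᵀ = p t) →
      (∀ t, 0 ≤ t → ∀ a b, |p t a b| ≤ B * T) →
      ∀ Y, Function.Periodic Y T → (∀ X U, IsFlow A (fun _ => W) R X U → (X 0).PosDef →
        Tendsto (fun t => X t - Y t) atTop (𝓝 0)) →
      ∀ t, 0 ≤ t → ∀ a b, |Y t a b - Xs a b| ≤ K * T := by
  set S := Xs⁻¹ with hSdef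
  have hS : S.PosDef := hX.inv
  have hXS : Xs * S = 1 := mul_nonsing_inv _ ((isUnit_iff_isUnit_det _).1 hX.isUnit)
  have hS0 : ric (-Aᵀ) R₀ W S = 0 := by
    have h1 := ric_dual_inv (A := A) (W := W) (R := R₀) hXS
    rw [hX0, eq_comm, neg_eq_zero] at h1
    have h2 : S * (Xs * ric (-Aᵀ) R₀ W S * Xs) * S = ric (-Aᵀ) R₀ W S := by
      rw [show S * (Xs * ric (-Aᵀ) R₀ W S * Xs) * S = S * Xs * ric (-Aᵀ) R₀ W S * (Xs * S) by
        noncomm_ring, hXS, mul_eq_one_comm.1 hXS]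
      simp
    rw [← h2, h1]; simp
  obtain ⟨L, hL, hΛ⟩ := exists_strict_lyapunov hW hc hR hS hS0
  set F := A + W * S
  set Λ := Fᵀ * L + L * F
  obtain ⟨f, hf, hF⟩ := exists_entry_le F
  obtain ⟨w, hw, hWb⟩ := exists_entry_le W
  obtain ⟨l, hl, hLb⟩ := exists_entry_le L
  obtain ⟨C, hC, hCb⟩ := exists_abs_quad_le hΛ
  obtain ⟨D, hD, hDb⟩ := exists_abs_quad_le hS
  set d : ℝ := (Fintype.card ι : ℝ)
  have hd : 0 ≤ d := Nat.cast_nonneg _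
  -- The first summand absorbs `Fᵀ p + p F`; the extra `1` leaves `T • Λ` for the quadratic term.
  -- Below, `g T` bounds the entries of `p ± κ T L`, and `m T ^ 2` bounds the quadratic term
  -- relative to `Λ`.
  let κ := C * (2 * (d * (f * B))) + 1
  have hκ : 0 < κ := by positivity
  let g := B + κ * l + 1
  have hg : 0 < g := by positivity
  let m := C * (d * (d * (g * w) * g))
  have hm : 0 ≤ m := by positivity
  refine ⟨2 * (D * g) * (∑ a, |Xs a a|) + 1, by positivity,
    -- The first bound gives `η = D g T ≤ 1 / 2`, the second `m T ≤ 1`.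
    min (1 / (2 * (D * g))) (1 / (m + 1)), lt_min (by positivity) (by positivity), ?_⟩
  intro T hT R h p hp hps hpb Y hY hYX t ht a b
  have hT0 := h.pos
  have hT1 : D * g * T ≤ 1 / 2 := by
    have := hT.trans (min_le_left _ _)
    rw [le_div_iff₀ (by positivity)] at this
    linarith
  have hT2 : m * T ≤ 1 := by
    have := hT.trans (min_le_right _ _)
    rw [le_div_iff₀ (by positivity)] at this
    linarith
  have hFp : ∀ t, 0 ≤ t → ∀ x, |quad (Fᵀ * p t + p t * F) x| ≤ (κ - 1) * T * quad Λ x := by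
    intro t ht x
    have h1 := hCb (Fᵀ * p t + p t * F) (2 * (d * (f * (B * T)))) (by positivity) (fun a b => by
      have e1 := abs_mul_entry_le (M := Fᵀ) hf (fun a b => hF b a) (hpb t ht) a b
      have e2 := abs_mul_entry_le (by positivity) (hpb t ht) hF a b
      refine (abs_add_le _ _).trans ((add_le_add e1 e2).trans_eq ?_)
      ring) x
    refine h1.trans_eq ?_
    simp only [κ]
    ring
  have hent : ∀ t, 0 ≤ t → ∀ c : ℝ, |c| ≤ κ * T → ∀ a b, |(p t + c • L) a b| ≤ g * T := by
    intro t ht c hc a b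
    have e1 : |c * L a b| ≤ κ * T * l := by
      rw [abs_mul]; exact mul_le_mul hc (hLb a b) (abs_nonneg _) (by positivity)
    have e2 := hpb t ht a b
    refine (abs_add_le _ _).trans ?_
    simp only [Matrix.smul_apply, smul_eq_mul, g]
    linarith
  have hDelta : ∀ t, 0 ≤ t → ∀ c : ℝ, |c| ≤ κ * T → ∀ x,
      |quad (p t + c • L) x| ≤ D * g * T * quad S x := by
    intro t ht c hc x
    refine (hDb _ (g * T) (by positivity) (hent t ht c hc) x).trans_eq ?_
    ring
  have hκT : |κ * T| ≤ κ * T := (abs_of_nonneg (by positivity)).le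
  have hκT' : |-(κ * T)| ≤ κ * T := by rw [abs_neg]; exact hκT
  have hsand := periodic_limit_sandwich (κ := κ * T) (η := D * g * T) h hS hXS hS0 hL hp hps
    (fun t ht x => by
      have e1 := le_of_abs_le (hFp t ht x)
      have e2 := hent t ht _ hκT'
      simp only [neg_smul, ← sub_eq_add_neg] at e2
      have e3 := le_of_abs_le (hCb _ _ (by positivity) (abs_mul_entry_le (by positivity)
        (abs_mul_entry_le (by positivity) e2 hWb) e2) x)
      have e4 := mul_le_mul_of_nonneg_right hT2
        (mul_nonneg hT0.le (psd_quad hΛ.posSemidef x))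
      rw [quad_sub, quad_sub, quad_smul]
      simp only [m] at e4
      nlinarith)
    -- Here the quadratic term has the favourable sign, so no smallness of `T` enters.
    (fun t ht x => by
      have e1 := neg_le_of_abs_le (hFp t ht x)
      have e2 := psd_quad hW ((p t + (κ * T) • L) *ᵥ x)
      have e4 := mul_nonneg hT0.le (psd_quad hΛ.posSemidef x)
      rw [quad_add, quad_add, quad_smul, quad_conj_symm (by
        rw [transpose_add, transpose_smul, hps t ht, hL])]
      linarith)
    (by positivity) hT1
    (fun t ht x => by
      have := hDelta t ht _ hκT' x
      rwa [neg_smul, ← sub_eq_add_neg] at this)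
    (fun t ht x => hDelta t ht _ hκT x) hY hYX ht
  have h1 := abs_entry_le (by rw [transpose_sub, hsand.1, pd_symm hX]) (pd_symm hX) hsand.2 a b
  have h2 : ∀ a, Xs a a ≤ ∑ a, |Xs a a| := fun a => (le_abs_self _).trans
    (Finset.single_le_sum (f := fun a => |Xs a a|) (fun _ _ => abs_nonneg _) (Finset.mem_univ a))
  refine (show |Y t a b - Xs a b| ≤ _ from h1).trans ?_
  have h3 : 0 ≤ 2 * (D * g * T) := by positivity
  have h4 := mul_le_mul_of_nonneg_left (show (Xs a a + Xs b b) / 2 ≤ ∑ a, |Xs a a| by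
    linarith [h2 a, h2 b]) h3
  linarith

end Averaging

end Riccati

namespace Riccati

open Matrix Set Filter Topology

/-! ### Controllability and unobservable directions -/

section Control

-- The square root `B` has the same kernel as `W`, since `quad W y = |B y| ^ 2`. A vector killed by
-- all `B Aᵀ ^ j` lies in the kernel of the transposed controllability matrix, which is trivial by
-- full rank.
open scoped MatrixOrder in
theorem ctrl_of_controllable {n : ℕ} {A W : Matrix (Fin n) (Fin n) ℝ} (hW : W.PosSemidef)
    (h : Controllable A (CFC.sqrt W)) : Ctrl A W := by
  intro v hv
  have hB : (CFC.sqrt W).PosSemidef := nonneg_iff_posSemidef.1 (CFC.sqrt_nonneg W)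
  have hBB : CFC.sqrt W * CFC.sqrt W = W :=
    CFC.sqrt_mul_sqrt_self W (nonneg_iff_posSemidef.2 hW)
  rw [Controllable] at h
  generalize CFC.sqrt W = B at h hB hBB
  have hBs := psd_symm hB
  have h1 : ∀ j : ℕ, B *ᵥ (Aᵀ ^ j *ᵥ v) = 0 := fun j => by
    refine dotProduct_self_eq_zero.1 ?_
    have h2 : quad W (Aᵀ ^ j *ᵥ v) = 0 := by rw [quad, hv j, dotProduct_zero]
    rwa [← hBB, quad_mul, hBs] at h2
  have h2 : (controllabilityMatrix A B)ᵀ *ᵥ v = 0 := by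
    ext q
    have h3 := congrFun (h1 q.1) q.2
    rw [mulVec_mulVec, ← transpose_pow, ← hBs, ← transpose_mul] at h3
    exact h3
  have h3 : LinearMap.ker (controllabilityMatrix A B)ᵀ.mulVecLin = ⊥ := by
    rw [← Submodule.finrank_eq_zero]
    have h4 := LinearMap.finrank_range_add_finrank_ker (controllabilityMatrix A B)ᵀ.mulVecLin
    have h5 : Module.finrank ℝ (LinearMap.range (controllabilityMatrix A B)ᵀ.mulVecLin) = n :=
      (rank_transpose _).trans h
    rw [h5, Module.finrank_fin_fun] at h4
    omega
  exact LinearMap.ker_eq_bot'.1 h3 v h2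

end Control

section Unobservable

variable {ι : Type*} [Fintype ι] [DecidableEq ι]

theorem exp_add_smul (A : Matrix ι ι ℝ) (s t : ℝ) :
    NormedSpace.exp ((s + t) • A) = NormedSpace.exp (s • A) * NormedSpace.exp (t • A) := by
  rw [add_smul, Matrix.exp_add_of_commute _ _ ((Commute.refl A).smul_left _ |>.smul_right _)]

/-- An output of a linear system that vanishes on an interval vanishes identically. -/
theorem output_eq_zero (A R : Matrix ι ι ℝ) {w : ι → ℝ} {a b : ℝ} (hab : a < b)
    (h : ∀ t, a ≤ t → t < b → R *ᵥ (NormedSpace.exp (t • A) *ᵥ w) = 0) (t : ℝ) :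
    R *ᵥ (NormedSpace.exp (t • A) *ᵥ w) = 0 := by
  set y := NormedSpace.exp (a • A) *ᵥ w with hy
  have hexp : ∀ s, NormedSpace.exp (s • A) *ᵥ y = NormedSpace.exp ((s + a) • A) *ᵥ w := fun s => by
    rw [hy, mulVec_mulVec, ← exp_add_smul]
  have key : ∀ j : ℕ, ∀ s, 0 ≤ s → s < b - a →
      R *ᵥ (A ^ j *ᵥ (NormedSpace.exp (s • A) *ᵥ y)) = 0 := by
    intro j
    induction j with
    | zero =>
      intro s hs hsb
      rw [pow_zero, one_mulVec, hexp]
      exact h _ (by linarith) (by linarith)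
    | succ j ih =>
      intro s hs hsb
      have h1 := ((rightDiff_exp A).const_mul (R * A ^ j)).mulVec_deriv_eq_zero (c := y)
        (T := b - a) (fun s hs hsb => by simpa [← mulVec_mulVec] using ih s hs hsb) hs hsb
      rw [pow_succ]
      simpa [← mulVec_mulVec] using h1
  -- All derivatives of the output vanish at time `a`, so the exponential series centred there
  -- vanishes at every time.
  have h2 := exp_smul_mem A (t - a) (B := R) (w := y) fun j => by
    have := key j 0 le_rfl (by linarith)
    rwa [zero_smul, NormedSpace.exp_zero, one_mulVec] at this
  rwa [hexp, sub_add_cancel] at h2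

end Unobservable

end Riccati

/-! ### The switching policy and its deviation from the average -/

namespace AssignmentDecomposition

open Set Filter Topology

variable {N M : ℕ} {P : Matrix (Fin N) (Fin M) ℝ} (D : AssignmentDecomposition P)

/-- The sum of the first `m` weights. -/
noncomputable def cum (m : ℕ) : ℝ := ∑ l ∈ Finset.univ.filter fun l : Fin D.K => (l : ℕ) < m, D.φ l

theorem cum_zero : D.cum 0 = 0 := by simp [cum]

theorem cum_K : D.cum D.K = 1 := by simp [cum, D.φ_sum]

theorem cum_mono : Monotone D.cum := fun a b hab =>
  Finset.sum_le_sum_of_subset_of_nonneg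
    (fun l hl => by simp only [Finset.mem_filter_univ] at hl ⊢; omega)
    fun l _ _ => (D.φ_pos l).le

theorem cum_succ (k : Fin D.K) : D.cum (k + 1) = D.cum k + D.φ k := by
  have : (Finset.univ.filter fun l : Fin D.K => (l : ℕ) < k + 1) =
      insert k (Finset.univ.filter fun l : Fin D.K => (l : ℕ) < k) := by
    ext l
    simp only [Finset.mem_filter_univ, Finset.mem_insert, Fin.ext_iff]
    omega
  rw [cum, this, Finset.sum_insert (by simp), add_comm, cum]

theorem cum_nonneg (m : ℕ) : 0 ≤ D.cum m := D.cum_zero ▸ D.cum_mono (Nat.zero_le m)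

theorem cum_le_one (k : Fin D.K) : D.cum (k + 1) ≤ 1 := D.cum_K ▸ D.cum_mono k.2

theorem K_pos : 0 < D.K := by
  rcases Nat.eq_zero_or_pos D.K with h | h
  · have h1 := D.cum_K
    rw [h, D.cum_zero] at h1
    exact absurd h1 zero_ne_one
  · exact h

theorem active_iff {ε t : ℝ} {k : Fin D.K} :
    D.Active ε k t ↔ D.cum k ≤ Int.fract (t / ε) ∧ Int.fract (t / ε) < D.cum (k + 1) := by
  have h1 : Finset.Iio k = Finset.univ.filter fun l : Fin D.K => (l : ℕ) < k := by
    ext l; simp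
  have h2 : Finset.Iic k = Finset.univ.filter fun l : Fin D.K => (l : ℕ) < k + 1 := by
    ext l; rw [Finset.mem_Iic, Finset.mem_filter_univ, Fin.le_def, Nat.lt_succ_iff]
  rw [Active, h1, h2, cum, cum]

theorem active_unique {ε t : ℝ} {k l : Fin D.K} (hk : D.Active ε k t) (hl : D.Active ε l t) :
    k = l := by
  rw [active_iff] at hk hl
  rcases lt_trichotomy (k : ℕ) l with h | h | h
  · linarith [D.cum_mono (Nat.succ_le_of_lt h)]
  · exact Fin.ext h
  · linarith [D.cum_mono (Nat.succ_le_of_lt h)]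

theorem exists_active (ε t : ℝ) : ∃ k, D.Active ε k t := by
  classical
  have h0 : ∃ m, Int.fract (t / ε) < D.cum m := ⟨D.K, D.cum_K ▸ Int.fract_lt_one _⟩
  have h1 := Nat.find_spec h0
  have h2 : Nat.find h0 ≠ 0 := fun h => by
    rw [h, D.cum_zero] at h1
    exact absurd h1 (not_lt.2 (Int.fract_nonneg _))
  obtain ⟨m, hm⟩ := Nat.exists_eq_succ_of_ne_zero h2
  have h3 : Nat.find h0 ≤ D.K := Nat.find_min' h0 (D.cum_K ▸ Int.fract_lt_one _)
  refine ⟨⟨m, by omega⟩, D.active_iff.2 ⟨not_lt.1 (Nat.find_min h0 (show m < _ by omega)), ?_⟩⟩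
  rwa [hm] at h1

theorem policy_eq {ε t : ℝ} {k : Fin D.K} (hk : D.Active ε k t) : D.policy ε t = D.assign k := by
  classical
  rw [policy, Finset.sum_eq_single k (fun l _ hl => if_neg fun h => hl (D.active_unique h hk))
    (by simp), if_pos hk]

theorem policy_periodic {ε : ℝ} (hε : 0 < ε) : Function.Periodic (D.policy ε) ε := fun t => by
  classical
  have h : ∀ k, D.Active ε k (t + ε) ↔ D.Active ε k t := fun k => by
    simp only [Active, add_div, div_self hε.ne', Int.fract_add_one]
  exact Finset.sum_congr rfl fun k _ => if_congr (h k) rfl rfl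

theorem isStep_policy {ε : ℝ} (hε : 0 < ε) : Riccati.IsStep (D.policy ε) := by
  have hK := D.K_pos
  let q : ℕ → Fin D.K := fun n => ⟨n % D.K, Nat.mod_lt _ hK⟩
  -- Switching times are enumerated by `n = l K + k`, with `l` the period and `k` the assignment;
  -- the last assignment of a period needs a separate case in `hb`.
  let b : ℕ → ℝ := fun n => ε * (((n / D.K : ℕ) : ℝ) + D.cum (n % D.K))
  have hb : ∀ n, b (n + 1) = ε * (((n / D.K : ℕ) : ℝ) + D.cum (n % D.K + 1)) := by
    intro n
    have h0 := Nat.div_add_mod n D.K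
    have hlt := Nat.mod_lt n hK
    simp only [b]
    by_cases h : n % D.K + 1 < D.K
    · have h1 : n + 1 = n % D.K + 1 + D.K * (n / D.K) := by omega
      have h2 : (n + 1) / D.K = n / D.K := by
        conv_lhs => rw [h1, Nat.add_mul_div_left _ _ hK, Nat.div_eq_of_lt h, zero_add]
      have h3 : (n + 1) % D.K = n % D.K + 1 := by
        conv_lhs => rw [h1, Nat.add_mul_mod_self_left, Nat.mod_eq_of_lt h]
      rw [h2, h3]
    · have h' : n % D.K + 1 = D.K := by omega
      have h1 : n + 1 = D.K * (n / D.K + 1) := by rw [Nat.mul_add]; omega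
      have h2 : (n + 1) / D.K = n / D.K + 1 := by
        conv_lhs => rw [h1, Nat.mul_div_cancel_left _ hK]
      have h3 : (n + 1) % D.K = 0 := by rw [h1, Nat.mul_mod_right]
      rw [h2, h3, h', D.cum_zero, D.cum_K]
      push_cast
      ring
  have hlt : ∀ n, D.cum (n % D.K) < D.cum (n % D.K + 1) := fun n => by
    have h1 := D.cum_succ (q n)
    have h2 := D.φ_pos (q n)
    simp only [q] at h1 h2
    linarith
  have hmono : StrictMono b := strictMono_nat_of_lt_succ fun n => by
    rw [hb]
    exact mul_lt_mul_of_pos_left (by linarith [hlt n]) hε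
  refine ⟨b, fun n => D.assign (q n), hmono, by simp [b, D.cum_zero], ?_, fun n t h1 h2 => ?_⟩
  · refine tendsto_atTop_atTop_of_monotone hmono.monotone fun x => ⟨⌈x / ε⌉₊ * D.K, ?_⟩
    have h1 := Nat.le_ceil (x / ε)
    rw [div_le_iff₀ hε] at h1
    simp only [b, Nat.mul_div_cancel _ hK, Nat.mul_mod_left, D.cum_zero, add_zero]
    linarith
  · refine D.policy_eq (D.active_iff.2 ?_)
    rw [hb, ← div_lt_iff₀' hε] at h2
    have h1' : ((n / D.K : ℕ) : ℝ) + D.cum (n % D.K) ≤ t / ε := by rwa [le_div_iff₀' hε]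
    have h3 : Int.fract (t / ε) = t / ε - ((n / D.K : ℕ) : ℝ) := by
      rw [Int.fract_eq_iff]
      have h4 := D.cum_nonneg (n % D.K)
      have h5 : D.cum (n % D.K + 1) ≤ 1 := D.cum_le_one (q n)
      exact ⟨by linarith, by linarith, ((n / D.K : ℕ) : ℤ), by rw [sub_sub_cancel, Int.cast_natCast]⟩
    rw [h3]
    exact ⟨by simp only [q]; linarith, by simp only [q]; linarith⟩

/-- The excess, at the fraction `x` of a period, of the time used by the `k`-th assignment over
its average share. -/
noncomputable def excess (k : Fin D.K) (x : ℝ) : ℝ := min (max (x - D.cum k) 0) (D.φ k) - D.φ k * x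

theorem abs_excess_le (k : Fin D.K) {x : ℝ} (h0 : 0 ≤ x) (h1 : x < 1) : |D.excess k x| ≤ 1 := by
  have h2 := D.φ_pos k
  have h3 : D.φ k ≤ 1 := by linarith [D.cum_succ k, D.cum_le_one k, D.cum_nonneg k]
  have h4 : 0 ≤ min (max (x - D.cum k) 0) (D.φ k) := le_min (le_max_right _ _) h2.le
  have h5 := min_le_right (max (x - D.cum k) 0) (D.φ k)
  rw [excess, abs_le]
  constructor <;> nlinarith

/-- The excess vanishes at both ends of a period, because each assignment has then used exactly its
share. -/
theorem continuous_excess (k : Fin D.K) (ε : ℝ) :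
    Continuous fun t : ℝ => ε * D.excess k (Int.fract (t / ε)) := by
  have h1 : Continuous (D.excess k) := by unfold excess; fun_prop
  have h2 : D.excess k 0 = D.excess k 1 := by
    have h3 := D.cum_succ k
    have h4 := D.cum_le_one k
    have h5 := D.cum_nonneg k
    have h6 := D.φ_pos k
    rw [excess, excess, max_eq_right (by linarith), min_eq_left h6.le, max_eq_left (by linarith),
      min_eq_right (by linarith)]
    ring
  have h3 : Continuous (D.excess k ∘ Int.fract) := h1.continuousOn.comp_fract'' h2
  exact continuous_const.mul (h3.comp (continuous_id.div_const ε))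

open scoped Classical in
theorem hasDerivWithinAt_excess (k : Fin D.K) {ε : ℝ} (hε : 0 < ε) (t : ℝ) :
    HasDerivWithinAt (fun t : ℝ => ε * D.excess k (Int.fract (t / ε)))
      ((if D.Active ε k t then 1 else 0) - D.φ k) (Ici t) t := by
  have hev : ∀ᶠ s in 𝓝[≥] t, t ≤ s ∧ Int.fract (s / ε) = s / ε - ⌊t / ε⌋ := by
    have h1 : t < ε * (⌊t / ε⌋ + 1) := by
      rw [← div_lt_iff₀' hε]; exact Int.lt_floor_add_one _
    filter_upwards [Ico_mem_nhdsGE h1] with s hs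
    refine ⟨hs.1, ?_⟩
    have h2 : t / ε ≤ s / ε := div_le_div_of_nonneg_right hs.1 hε.le
    have h3 : s / ε < ⌊t / ε⌋ + 1 := by rw [div_lt_iff₀' hε]; exact hs.2
    rw [Int.fract_eq_iff]
    exact ⟨by linarith [Int.floor_le (t / ε)], by linarith, ⌊t / ε⌋, by ring⟩
  have hcont : Tendsto (fun s : ℝ => s / ε - ⌊t / ε⌋) (𝓝[≥] t) (𝓝 (Int.fract (t / ε))) :=
    ((continuous_id.div_const ε).sub continuous_const).continuousWithinAt
  -- To the right of `t` the truncated ramp is affine in `s / ε`: slope `1` while `k` is active,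
  -- slope `0` before and after.
  have key : ∀ c m : ℝ, (∀ᶠ s in 𝓝[≥] t, min (max (s / ε - ⌊t / ε⌋ - D.cum k) 0) (D.φ k) =
      c + m * (s / ε)) → HasDerivWithinAt (fun t : ℝ => ε * D.excess k (Int.fract (t / ε)))
      (m - D.φ k) (Ici t) t := by
    intro c m hm
    have h1 : HasDerivWithinAt
        (fun s : ℝ => ε * (c + m * (s / ε) - D.φ k * (s / ε - ⌊t / ε⌋)))
        (ε * (m * (1 / ε) - D.φ k * (1 / ε))) (Ici t) t := by
      have h2 : HasDerivWithinAt (fun s : ℝ => s / ε) (1 / ε) (Ici t) t :=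
        (hasDerivWithinAt_id t _).div_const ε
      exact (((h2.const_mul m).const_add c).sub ((h2.sub_const _).const_mul _)).const_mul ε
    have h3 : ε * (m * (1 / ε) - D.φ k * (1 / ε)) = m - D.φ k := by field_simp
    rw [h3] at h1
    have he : (fun t : ℝ => ε * D.excess k (Int.fract (t / ε))) =ᶠ[𝓝[≥] t]
        fun s => ε * (c + m * (s / ε) - D.φ k * (s / ε - ⌊t / ε⌋)) := by
      filter_upwards [hev, hm] with s hs hms
      rw [hs.2, excess, hms]
    exact h1.congr_of_eventuallyEq he (he.self_of_nhdsWithin self_mem_Ici)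
  have hφ := D.φ_pos k
  have hs := D.cum_succ k
  by_cases ha : D.Active ε k t
  · rw [if_pos ha]
    rw [active_iff] at ha
    refine key (-⌊t / ε⌋ - D.cum k) 1 ?_
    filter_upwards [hev, hcont.eventually_lt_const ha.2] with s h1 h2
    have h3 : t / ε ≤ s / ε := div_le_div_of_nonneg_right h1.1 hε.le
    have h4 := Int.self_sub_floor (t / ε)
    rw [max_eq_left (by linarith), min_eq_left (by linarith)]
    ring
  · rw [if_neg ha]
    rw [active_iff, not_and_or, not_le, not_lt] at ha
    rcases ha with ha | ha
    · refine key 0 0 ?_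
      filter_upwards [hcont.eventually_lt_const ha] with s h1
      rw [max_eq_right (by linarith), min_eq_left hφ.le]
      ring
    · refine key (D.φ k) 0 ?_
      filter_upwards [hev] with s h1
      have h3 : t / ε ≤ s / ε := div_le_div_of_nonneg_right h1.1 hε.le
      have h4 := Int.self_sub_floor (t / ε)
      rw [max_eq_left (by linarith), min_eq_right (by linarith)]
      ring

end AssignmentDecomposition

/-! ### Application to the sensor model -/

namespace SensorModel

open Matrix Set Filter Topology Riccati

variable {N M : ℕ} (S : SensorModel N M)

theorem info_posSemidef (i : Fin N) {w : Fin M → ℝ} (hw : ∀ j, 0 ≤ w j) :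
    (S.info i w).PosSemidef := by
  refine posSemidef_sum _ fun j _ => PosSemidef.smul ?_ (hw j)
  have := (S.V_posDef i j).inv.posSemidef.conjTranspose_mul_mul_same (S.C i j)
  rwa [conjTranspose_eq_transpose_of_trivial] at this

theorem info_sum (i : Fin N) {K : Type*} [Fintype K] (c : K → ℝ) (w : K → Fin M → ℝ) :
    S.info i (∑ k, c k • w k) = ∑ k, c k • S.info i (w k) := by
  simp only [info, Finset.smul_sum, Finset.sum_apply, Pi.smul_apply, Finset.sum_smul, smul_smul,
    smul_eq_mul]
  exact Finset.sum_comm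

theorem isErrorCovariance_iff {i : Fin N} {π : ℝ → Matrix (Fin N) (Fin M) ℝ}
    {X : ℝ → Matrix (Fin (S.n i)) (Fin (S.n i)) ℝ} :
    S.IsErrorCovariance i π X ↔ X 0 = S.cov0 i ∧
      RightDiff X fun t => ric (S.A i) (S.W i) (S.info i (π t i)) (X t) :=
  ⟨fun h => ⟨h.initial, h.continuousOn, h.equation⟩, fun h => ⟨h.1, h.2.cont, h.2.deriv⟩⟩

variable {P : Matrix (Fin N) (Fin M) ℝ} (D : AssignmentDecomposition P)

theorem info_eq_sum (i : Fin N) : S.info i (P i) = ∑ k, D.φ k • S.info i (D.assign k i) := by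
  rw [← info_sum]
  congr 1
  conv_lhs => rw [D.decomposition]
  ext j
  simp [Matrix.sum_apply]

theorem info_assign_posSemidef (i : Fin N) (k : Fin D.K) :
    (S.info i (D.assign k i)).PosSemidef :=
  S.info_posSemidef i fun j => by
    rcases (D.isAssignment k).zero_or_one i j with h | h <;> simp [h]

theorem periodicSystem (i : Fin N) (hc : Ctrl (S.A i) (S.W i)) {ε : ℝ} (hε : 0 < ε) :
    PeriodicSystem (S.A i) (S.W i) (fun t => S.info i (D.policy ε t i)) ε where
  W_psd := S.W_posSemidef i
  ctrl := hc
  R_psd t _ := by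
    obtain ⟨k, hk⟩ := D.exists_active ε t
    rw [D.policy_eq hk]
    exact S.info_assign_posSemidef D i k
  R_step := (D.isStep_policy hε).map fun Q => S.info i (Q i)
  pos := hε
  periodic t := by simp only [D.policy_periodic hε t]

/-- Each assignment is used on an interval of positive length, so an output invisible to the policy
over one period is invisible to every assignment at all times, hence to their average. -/
theorem hasSuper (i : Fin N) (hc : Ctrl (S.A i) (S.W i)) (hP : S.Feasible P) {ε : ℝ}
    (hε : 0 < ε) :
    HasSuper (S.A i) (S.W i) (fun t => S.info i (D.policy ε t i)) ε := by
  obtain ⟨Q, hQ, hineq⟩ := hP.riccati_inequality i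
  refine (S.periodicSystem D i hc hε).hasSuper hQ hineq fun w hw t _ _ => ?_
  rw [S.info_eq_sum D i, sum_mulVec]
  refine Finset.sum_eq_zero fun k _ => ?_
  rw [smul_mulVec, output_eq_zero (S.A i) (S.info i (D.assign k i)) (w := w)
    (a := ε * D.cum k) (b := ε * D.cum (k + 1)) ?_ ?_ t, smul_zero]
  · exact mul_lt_mul_of_pos_left (by linarith [D.cum_succ k, D.φ_pos k]) hε
  · intro s h1 h2
    have h3 : 0 ≤ s := (mul_nonneg hε.le (D.cum_nonneg k)).trans h1
    have h4 : s < ε := h2.trans_le (by nlinarith [D.cum_le_one k])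
    have h5 : Int.fract (s / ε) = s / ε :=
      Int.fract_eq_self.2 ⟨div_nonneg h3 hε.le, by rwa [div_lt_one hε]⟩
    have h6 : D.Active ε k s := by
      rw [D.active_iff, h5, le_div_iff₀' hε, div_lt_iff₀' hε]
      exact ⟨h1, h2⟩
    have := hw s h3 h4
    rwa [D.policy_eq h6] at this

/-- The primitive is the sum of the information matrices of the assignments weighted by `ε` times
their excess; excesses are bounded by one, so `B` does not depend on `ε`. -/
theorem exists_deviation (i : Fin N) : ∃ B : ℝ, 0 ≤ B ∧ ∀ ε, 0 < ε →
    ∃ p, RightDiff p (fun t => S.info i (D.policy ε t i) - S.info i (P i)) ∧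
      (∀ t, (p t)ᵀ = p t) ∧ ∀ t a b, |p t a b| ≤ B * ε := by
  classical
  choose r hr hrb using fun k => exists_entry_le (S.info i (D.assign k i))
  refine ⟨∑ k, r k, Finset.sum_nonneg fun k _ => hr k, fun ε hε =>
    ⟨fun t => ∑ k, (ε * D.excess k (Int.fract (t / ε))) • S.info i (D.assign k i),
      .of_entries (fun a b => ?_) (fun t _ a b => ?_), fun t => ?_, fun t a b => ?_⟩⟩
  · simp only [Matrix.sum_apply, Matrix.smul_apply, smul_eq_mul]
    exact continuousOn_finsetSum _ fun k _ =>
      (D.continuous_excess k ε).continuousOn.mul continuousOn_const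
  · obtain ⟨k₀, hk₀⟩ := D.exists_active ε t
    have h1 : S.info i (D.policy ε t i) - S.info i (P i) =
        ∑ k, ((if D.Active ε k t then 1 else 0) - D.φ k) • S.info i (D.assign k i) := by
      simp only [sub_smul, Finset.sum_sub_distrib, ← S.info_eq_sum D i]
      rw [Finset.sum_eq_single k₀ (fun l _ hl => by
        rw [if_neg fun h => hl (D.active_unique h hk₀), zero_smul]) (by simp), if_pos hk₀, one_smul,
        D.policy_eq hk₀]
    rw [h1]
    simp only [Matrix.sum_apply, Matrix.smul_apply, smul_eq_mul]
    exact HasDerivWithinAt.fun_sum fun k _ =>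
      (D.hasDerivWithinAt_excess k hε t).mul_const _
  · rw [transpose_sum]
    exact Finset.sum_congr rfl fun k _ => by
      rw [transpose_smul, psd_symm (S.info_assign_posSemidef D i k)]
  · simp only [Matrix.sum_apply, Matrix.smul_apply, smul_eq_mul, Finset.sum_mul]
    refine (Finset.abs_sum_le_sum_abs _ _).trans (Finset.sum_le_sum fun k _ => ?_)
    rw [abs_mul, abs_mul, abs_of_pos hε]
    have h1 := D.abs_excess_le k (Int.fract_nonneg (t / ε)) (Int.fract_lt_one _)
    calc _ ≤ ε * 1 * r k := by
          gcongr
          exact hrb k a b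
      _ = _ := by ring

end SensorModel

/-! ### Assembly -/

open Riccati

theorem mainTheorem5 {N M : ℕ} (S : SensorModel N M)
    (hcov0 : ∀ i, (S.cov0 i).PosDef)
    (hdet : S.SitesDetectable)
    (hctrl : S.SitesControllable)
    (P : Matrix (Fin N) (Fin M) ℝ) (hP : S.Feasible P)
    (D : AssignmentDecomposition P) (i : Fin N) :
    (∃! Xstar, S.IsStabilizingSolution i (P i) Xstar) ∧
    (∀ ε : ℝ, 0 < ε → ∃! Y, S.IsPeriodicLimit D i ε Y) ∧
    ∃ K > (0 : ℝ), ∃ ε₀ > (0 : ℝ),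
      ∀ Xstar, S.IsStabilizingSolution i (P i) Xstar →
      ∀ ε : ℝ, 0 < ε → ε ≤ ε₀ → ∀ Y, S.IsPeriodicLimit D i ε Y →
      ∀ t : ℝ, 0 ≤ t → ∀ a b, |Y t a b - Xstar a b| ≤ K * ε := by
  have hc : Ctrl (S.A i) (S.W i) := ctrl_of_controllable (S.W_posSemidef i) (hctrl i)
  have hW := S.W_posSemidef i
  have hR : (S.info i (P i)).PosSemidef := S.info_posSemidef i (hP.nonneg i)
  obtain ⟨Q, hQ, hineq⟩ := hP.riccati_inequality i
  obtain ⟨hs, Xs, hXs, hXs0⟩ := exists_equilibrium hW hc hR hQ hineq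
  have huniq : ∀ X, S.IsStabilizingSolution i (P i) X → X = Xs := fun X hX =>
    equilibrium_unique hW hc hR hs hX.posDef hXs hX.equation hXs0
  have hlim : ∀ ε, 0 < ε → ∃ Y, S.IsPeriodicLimit D i ε Y ∧
      (∀ Y', S.IsPeriodicLimit D i ε Y' → Y' = Y) ∧
      ∀ X U, IsFlow (S.A i) (fun _ => S.W i) (fun t => S.info i (D.policy ε t i)) X U →
        (X 0).PosDef → Filter.Tendsto (fun t => X t - Y t) Filter.atTop (nhds 0) := by
    intro ε hε
    have h := S.periodicSystem D i hc hε
    obtain ⟨Y, hY, hYX⟩ := h.exists_periodic (S.hasSuper D i hc hP hε)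
    obtain ⟨X, U, hX, hX0⟩ := h.exists_flow (hcov0 i).posSemidef
    have hXY := hYX X U hX (hX0 ▸ hcov0 i)
    refine ⟨Y, ⟨hY, X, S.isErrorCovariance_iff.2 ⟨hX0, hX.sol⟩, hXY⟩, ?_, hYX⟩
    rintro Y' ⟨hY', X', hX', hX'Y'⟩
    rw [S.isErrorCovariance_iff] at hX'
    -- Both limits belong to the same error covariance, by uniqueness of the initial value problem.
    -- Two functions of period `ε` whose difference tends to zero coincide.
    have hd : Filter.Tendsto (fun t => Y' t - Y t) Filter.atTop (nhds 0) := by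
      have h1 := hXY.sub hX'Y'
      rw [sub_zero] at h1
      refine h1.congr' ?_
      filter_upwards [Filter.eventually_ge_atTop 0] with t ht
      rw [hX.eq_of_sol h.R_step hX'.2 (hX'.1.trans hX0.symm) ht]
      abel
    funext t
    refine tendsto_nhds_unique (tendsto_const_nhds.congr fun n => ?_)
      (tendsto_of_periodic hε hY hd t)
    exact (hY'.nat_mul n t).symm
  refine ⟨⟨Xs, ⟨hXs, hXs0, fun z hz => equilibrium_hurwitz hW hc hR hXs hXs0 hz⟩, huniq⟩,
    fun ε hε => ?_, ?_⟩
  · obtain ⟨Y, hY, hY', -⟩ := hlim ε hε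
    exact ⟨Y, hY, hY'⟩
  · obtain ⟨B, hB, hp⟩ := S.exists_deviation D i
    obtain ⟨K, hK, ε₀, hε₀, hmain⟩ := exists_averaging_bound hW hc hR hXs hXs0 hB
    refine ⟨K, hK, ε₀, hε₀, fun X hX ε hε hεε₀ Y hY => ?_⟩
    obtain ⟨Y', hY', hu, hconv⟩ := hlim ε hε
    obtain ⟨p, hp1, hp2, hp3⟩ := hp ε hε
    rw [huniq X hX, hu Y hY]
    exact hmain ε hεε₀ _ (S.periodicSystem D i hc hε) p hp1 (fun t _ => hp2 t)
      (fun t _ => hp3 t) Y' hY'.1 hconv
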